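/- Let $n\ge 5$ and let $G=SO(n-2)$ act on the unit sphere $S^n\subset\mathbb R^3\times\mathbb R^{n-2}=\mathbb R^{n+1}$ by $A\cdot(x,y)=(x,Ay)$, i.e. by the standard action fixing the first three coordinates. Let $M^{reg}\subset S^n$ be the regular part, i.e. the set of points whose orbit type is maximal. For a $G$-invariant Riemannian metric $g$ on $S^n$, equip $M^{reg}/G$ with the Riemannian metric for which $M^{reg}\to M^{reg}/G$ is a Riemannian submersion; and for a biinvariant metric $Q$ on $G$ and $t>0$ let $g_t$ (the Cheeger deformation of $g$ with respect to $Q$) be the metric on $S^n$ for which $(S^n\times G,\ g+\tfrac1t Q)\to (S^n,g_t)$, $(q,a)\mapsto aq$, is a Riemannian submersion; put $g_0=g$. Then there is a smooth $G$-invariant Riemannian metric $g$ on $S^n$ such that: 1. $\mathrm{Ric}_{M^{reg}/G}\ge 1$; 2. there are a point $p\in S^n$ and a vector $X\in T_pS^n$ that is $g$-orthogonal to the orbit $Gp$ such that $\mathrm{Ric}_{g_t}(X,X)<0$ for every Cheeger deformation $g_t$ of $g$, that is, for every biinvariant metric $Q$ on $G$ and every $t\ge 0$. -/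

import Mathlib

open scoped Manifold ContDiff Matrix
open Metric (sphere)

noncomputable section

/-! ### Ricci curvature of a Riemannian metric, in charts -/

/-- The model space `ℝᵈ`. -/
abbrev Euc (d : ℕ) : Type := EuclideanSpace ℝ (Fin d)

/-- Smooth Riemannian metrics on a smooth manifold `M` of dimension `d` (without boundary). -/
abbrev SmoothMetric (d : ℕ) (M : Type) [TopologicalSpace M] [ChartedSpace (Euc d) M]
    [IsManifold (𝓡 d) ∞ M] : Type :=
  Bundle.ContMDiffRiemannianMetric (𝓡 d) ∞ (Euc d) (fun x : M => TangentSpace (𝓡 d) x)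

/-- The Christoffel map `Γ(y)(u, v)` of a metric `G` given on (an open subset of) `ℝᵈ`: the vector
determined by
`G(y)(Γ(y)(u, v), w) = ½ (D_u G (v, w) + D_v G (u, w) - D_w G (u, v))` for all `w`.
It is the covariant derivative `∇_u v` of the constant vector field `v` in the direction `u`.
The inverse `(G y).inverse` is a genuine inverse of `u ↦ G y u ·` as soon as `G y` is positive
definite. -/
def christoffel {d : ℕ} (G : Euc d → Euc d →L[ℝ] Euc d →L[ℝ] ℝ) (y u v : Euc d) : Euc d :=
  (G y).inverse
    ((1 / 2 : ℝ) • (fderiv ℝ G y u v + fderiv ℝ G y v u - ((fderiv ℝ G y).flip u).flip v))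

/-- The curvature `R(u, v) w = ∇_u ∇_v w - ∇_v ∇_u w` of `G` at `y`, for vectors `u, v, w` that are
extended to constant vector fields (so that `[u, v] = 0`). -/
def curvature {d : ℕ} (G : Euc d → Euc d →L[ℝ] Euc d →L[ℝ] ℝ) (y u v w : Euc d) : Euc d :=
  (fderiv ℝ (fun z => christoffel G z v w) y u + christoffel G y u (christoffel G y v w))
    - (fderiv ℝ (fun z => christoffel G z u w) y v + christoffel G y v (christoffel G y u w))

/-- The Ricci tensor `Ric(v, w)` of `G` at `y`: the trace of `u ↦ R(u, v) w`. -/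
def ricciCoord {d : ℕ} (G : Euc d → Euc d →L[ℝ] Euc d →L[ℝ] ℝ) (y v w : Euc d) : ℝ :=
  ∑ i : Fin d, curvature G y (EuclideanSpace.single i 1) v w i

section Ricci

variable {d : ℕ} {M : Type} [TopologicalSpace M] [ChartedSpace (Euc d) M] [IsManifold (𝓡 d) ∞ M]

/-- The metric `g` written in the preferred chart `φ` at `p`, that is, `(φ⁻¹)^* g`. -/
def metricInChart (g : SmoothMetric d M) (p : M) (y : Euc d) : Euc d →L[ℝ] Euc d →L[ℝ] ℝ :=
  let D : Euc d →L[ℝ] Euc d := mfderiv (𝓡 d) (𝓡 d) (extChartAt (𝓡 d) p).symm y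
  let b : Euc d →L[ℝ] Euc d →L[ℝ] ℝ := g.inner ((extChartAt (𝓡 d) p).symm y)
  b.bilinearComp D D

lemma metricInChart_apply (g : SmoothMetric d M) (p : M) (y u v : Euc d) :
    metricInChart g p y u v = g.inner ((extChartAt (𝓡 d) p).symm y)
      (mfderiv (𝓡 d) (𝓡 d) (extChartAt (𝓡 d) p).symm y u)
      (mfderiv (𝓡 d) (𝓡 d) (extChartAt (𝓡 d) p).symm y v) :=
  rfl

/-- The Ricci tensor `Ric_g(v, w)` at `p`, computed in the preferred chart at `p`. In Mathlib a
tangent vector at `p` is by definition its coordinate vector in that chart. -/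
def ricci (g : SmoothMetric d M) (p : M) (v w : TangentSpace (𝓡 d) p) : ℝ :=
  ricciCoord (metricInChart g p) (extChartAt (𝓡 d) p p) v w

end Ricci

/-! ### Riemannian submersions -/

/-- The linear map `L : V → W` is the differential of a Riemannian submersion for the inner products
`b` on `V` and `c` on `W`: it is onto, and it is isometric on the orthogonal complement of its
kernel. -/
def IsMetricSubmersion {V W : Type} [Zero W] (b : V → V → ℝ) (c : W → W → ℝ) (L : V → W) : Prop :=
  Function.Surjective L ∧
    ∀ z z' : V, (∀ k, L k = 0 → b z k = 0) → (∀ k, L k = 0 → b z' k = 0) →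
      c (L z) (L z') = b z z'

/-! ### The sphere and the action of `SO(m)` -/

/-- `ℝ³ × ℝᵐ` with its Euclidean norm. -/
abbrev Amb (m : ℕ) : Type := EuclideanSpace ℝ (Fin 3 ⊕ Fin m)

instance factFinrankAmb (m : ℕ) : Fact (Module.finrank ℝ (Amb m) = (m + 2) + 1) :=
  ⟨by simp; omega⟩

/-- The unit sphere of `ℝ³ × ℝᵐ = ℝ^{m+3}`, a smooth manifold of dimension `m + 2`. -/
abbrev Sph (m : ℕ) : Type := sphere (0 : Amb m) 1

/-- The group `SO(m)`. -/
abbrev SO (m : ℕ) : Type := Matrix.specialOrthogonalGroup (Fin m) ℝ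

/-- The Lie algebra `𝔰𝔬(m)` of skew-symmetric matrices. -/
abbrev LieSO (m : ℕ) : Type := LieAlgebra.Orthogonal.so (Fin m) ℝ

/-- The linear action of a matrix `A` on `ℝ³ × ℝᵐ` through the block matrix `diag(1, 1, 1, A)`. -/
def blockAct {m : ℕ} (A : Matrix (Fin m) (Fin m) ℝ) (x : Amb m) : Amb m :=
  WithLp.toLp 2 (Matrix.fromBlocks 1 0 0 A *ᵥ x.ofLp)

lemma SO_transpose_mul {m : ℕ} (A : SO m) : (A : Matrix (Fin m) (Fin m) ℝ)ᵀ * A = 1 := by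
  have h := (Matrix.mem_specialOrthogonalGroup_iff.1 A.2).1
  have h' := (Matrix.mem_orthogonalGroup_iff' (Fin m) ℝ).1 h
  simpa [Matrix.star_eq_conjTranspose] using h'

lemma blockAct_norm {m : ℕ} (A : SO m) (x : Amb m) : ‖blockAct (A : Matrix _ _ ℝ) x‖ = ‖x‖ := by
  have key : ∀ z : Amb m, ‖z‖ ^ 2 = z.ofLp ⬝ᵥ z.ofLp := fun z => by
    rw [EuclideanSpace.norm_sq_eq]
    simp [dotProduct, sq]
  have h : ‖blockAct (A : Matrix _ _ ℝ) x‖ ^ 2 = ‖x‖ ^ 2 := by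
    rw [key, key]
    simp only [blockAct]
    rw [Matrix.dotProduct_mulVec, Matrix.vecMul_mulVec, Matrix.fromBlocks_transpose,
      Matrix.fromBlocks_multiply]
    simp [SO_transpose_mul]
  exact (sq_eq_sq₀ (norm_nonneg _) (norm_nonneg _)).1 h

/-- The standard action of `SO(m)` on the unit sphere of `ℝ³ × ℝᵐ`, fixing the first three
coordinates. -/
instance sphAction (m : ℕ) : MulAction (SO m) (Sph m) where
  smul A p := ⟨blockAct (A : Matrix _ _ ℝ) p.1, by
    rw [mem_sphere_zero_iff_norm, blockAct_norm]
    exact mem_sphere_zero_iff_norm.1 p.2⟩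
  one_smul p := Subtype.ext (by
    change blockAct (1 : Matrix (Fin m) (Fin m) ℝ) p.1 = p.1
    simp [blockAct])
  mul_smul A B p := Subtype.ext (by
    change blockAct (A.1 * B.1) p.1 = blockAct A.1 (blockAct B.1 p.1)
    simp [blockAct, Matrix.mulVec_mulVec, Matrix.fromBlocks_multiply])

lemma exp_mem_SO {m : ℕ} (U : LieSO m) :
    NormedSpace.exp (U : Matrix (Fin m) (Fin m) ℝ) ∈ Matrix.specialOrthogonalGroup (Fin m) ℝ := by
  have orth : ∀ V : Matrix (Fin m) (Fin m) ℝ, Vᵀ = -V →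
      (NormedSpace.exp V)ᵀ * NormedSpace.exp V = 1 := fun V hV => by
    rw [← Matrix.exp_transpose, hV, ← Matrix.exp_add_of_commute _ _ (Commute.neg_left (Commute.refl V))]
    simp
  have hU : (U : Matrix (Fin m) (Fin m) ℝ)ᵀ = -U := (LieAlgebra.Orthogonal.mem_so _ _ _).1 U.2
  refine Matrix.mem_specialOrthogonalGroup_iff.2 ⟨?_, ?_⟩
  · refine (Matrix.mem_orthogonalGroup_iff' (Fin m) ℝ).2 ?_
    simpa [Matrix.star_eq_conjTranspose] using orth _ hU
  · set V : Matrix (Fin m) (Fin m) ℝ := (1 / 2 : ℝ) • U.1 with hVdef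
    have hV : Vᵀ = -V := by simp [hVdef, hU]
    have hUV : U.1 = V + V := by rw [hVdef, ← add_smul]; norm_num
    have h1 := congrArg Matrix.det (orth V hV)
    rw [Matrix.det_mul, Matrix.det_transpose, Matrix.det_one] at h1
    rw [hUV, Matrix.exp_add_of_commute _ _ (Commute.refl V), Matrix.det_mul, h1]

/-- The exponential map `𝔰𝔬(m) → SO(m)`. -/
def expSO {m : ℕ} (U : LieSO m) : SO m := ⟨NormedSpace.exp (U : Matrix _ _ ℝ), exp_mem_SO U⟩

/-- The adjoint representation `Ad_A U = A U A⁻¹ = A U Aᵀ`. -/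
def Ad {m : ℕ} (A : SO m) (U : LieSO m) : LieSO m :=
  ⟨A.1 * U.1 * A.1ᵀ, by
    have hU : (U : Matrix (Fin m) (Fin m) ℝ)ᵀ = -U := (LieAlgebra.Orthogonal.mem_so _ _ _).1 U.2
    rw [LieAlgebra.Orthogonal.mem_so]
    simp [Matrix.transpose_mul, hU, Matrix.mul_assoc]⟩

/-- `Q` is (the value at the identity of) a biinvariant Riemannian metric on `SO(m)`: an
`Ad`-invariant inner product on `𝔰𝔬(m)`. -/
structure IsBiinvariant {m : ℕ} (Q : LinearMap.BilinForm ℝ (LieSO m)) : Prop where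
  symm : ∀ U V, Q U V = Q V U
  pos : ∀ U, U ≠ 0 → 0 < Q U U
  ad : ∀ (A : SO m) (U V : LieSO m), Q (Ad A U) (Ad A V) = Q U V

/-- The action field `U*_p = d/ds|_{s=0} exp(sU) p`. -/
def actionField {m : ℕ} (U : LieSO m) (p : Sph m) : TangentSpace (𝓡 (m + 2)) p :=
  (mfderiv 𝓘(ℝ, ℝ) (𝓡 (m + 2)) (fun s : ℝ => expSO (s • U) • p) 0 (1 : ℝ) : Euc (m + 2))

/-- The differential at `p` of the diffeomorphism `q ↦ A q`. -/
def dAct {m : ℕ} (A : SO m) (p : Sph m) (v : TangentSpace (𝓡 (m + 2)) p) :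
    TangentSpace (𝓡 (m + 2)) (A • p) :=
  mfderiv (𝓡 (m + 2)) (𝓡 (m + 2)) (fun q : Sph m => A • q) p v

/-- Riemannian metrics on the sphere. -/
abbrev SphMetric (m : ℕ) : Type := SmoothMetric (m + 2) (Sph m)

/-- The metric `g` is `SO(m)`-invariant. -/
def IsSOInvariant {m : ℕ} (g : SphMetric m) : Prop :=
  ∀ (A : SO m) (p : Sph m) (u v : TangentSpace (𝓡 (m + 2)) p),
    g.inner (A • p) (dAct A p u) (dAct A p v) = g.inner p u v

/-- `X ∈ 𝓗_p`: the vector `X` is `g`-orthogonal to the orbit through `p`. -/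
def IsHorizontal {m : ℕ} (g : SphMetric m) (p : Sph m) (X : TangentSpace (𝓡 (m + 2)) p) : Prop :=
  ∀ U : LieSO m, g.inner p X (actionField U p) = 0

/-! ### The regular part and its quotient -/

/-- The regular part: the points whose orbit type is maximal, i.e. whose isotropy group is contained,
up to conjugation, in every other isotropy group (recall `G_{Aq} = A G_q A⁻¹`). -/
def regularPart (m : ℕ) : Set (Sph m) :=
  {p | ∀ q : Sph m, ∃ A : SO m,
    MulAction.stabilizer (SO m) p ≤ MulAction.stabilizer (SO m) (A • q)}

/-- The Riemannian manifold `(B, h)`, with the projection `π` (of which only the values on the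
regular part matter), is the Riemannian quotient `M^reg/G` of `(M, g)`: the map `π : M^reg → B` is
a smooth surjective Riemannian submersion whose fibres are exactly the orbits. These properties
determine `(B, h)` up to isometry. -/
structure IsRegularQuotient {m d : ℕ} {B : Type} [TopologicalSpace B] [ChartedSpace (Euc d) B]
    [IsManifold (𝓡 d) ∞ B] (g : SphMetric m) (h : SmoothMetric d B) (π : Sph m → B) : Prop where
  smooth : ContMDiffOn (𝓡 (m + 2)) (𝓡 d) ∞ π (regularPart m)
  surj : π '' regularPart m = Set.univ
  fibres : ∀ p ∈ regularPart m, ∀ q ∈ regularPart m, π p = π q ↔ q ∈ MulAction.orbit (SO m) p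
  submersion : ∀ p ∈ regularPart m,
    IsMetricSubmersion (fun u v => g.inner p u v) (fun u v => h.inner (π p) u v)
      (fun u => mfderiv (𝓡 (m + 2)) (𝓡 d) π p u)

/-- `Ric_{M^reg/G} ≥ c`. -/
def RegularQuotientRicciGE {m : ℕ} (g : SphMetric m) (c : ℝ) : Prop :=
  ∃ (d : ℕ) (B : Type) (_ : TopologicalSpace B) (_ : ChartedSpace (Euc d) B)
    (_ : IsManifold (𝓡 d) ∞ B) (h : SmoothMetric d B) (π : Sph m → B),
    IsRegularQuotient g h π ∧
      ∀ (b : B) (v : TangentSpace (𝓡 d) b), c * h.inner b v v ≤ ricci h b v v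

/-! ### Cheeger deformations -/

/-- The differential at `(q, a)` of `π' : M × G → M`, `π'(q, a) = a q`. A tangent vector of `G` at `a`
is written as `d/ds|_{s=0} exp(sU) a` with `U ∈ 𝔤`. -/
def cheegerProjDeriv {m : ℕ} (q : Sph m) (a : SO m)
    (z : TangentSpace (𝓡 (m + 2)) q × LieSO m) : TangentSpace (𝓡 (m + 2)) (a • q) :=
  dAct a q z.1 + actionField z.2 (a • q)

/-- The product metric `g + (1/t) Q` on `M × G` at `(q, a)`. -/
def cheegerProduct {m : ℕ} (g : SphMetric m) (Q : LinearMap.BilinForm ℝ (LieSO m)) (t : ℝ)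
    (q : Sph m) (z z' : TangentSpace (𝓡 (m + 2)) q × LieSO m) : ℝ :=
  g.inner q z.1 z'.1 + (1 / t) * Q z.2 z'.2

/-- `gt` is the Cheeger deformation of the invariant metric `g` with parameter `t > 0`, with respect
to the biinvariant metric `Q`: the metric on `M` for which `π' : (M × G, g + (1/t) Q) → (M, gt)`,
`(q, a) ↦ a q`, is a Riemannian submersion. -/
def IsCheegerDeformation {m : ℕ} (g : SphMetric m) (Q : LinearMap.BilinForm ℝ (LieSO m)) (t : ℝ)
    (gt : SphMetric m) : Prop :=
  ∀ (q : Sph m) (a : SO m),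
    IsMetricSubmersion (cheegerProduct g Q t q) (fun u v => gt.inner (a • q) u v)
      (cheegerProjDeriv q a)

end

/-! The metric is `F⁻²` times the round one, with `F = 7 + 3(x₀² + x₁²)`. At a critical point of `F`
on a round `d`-sphere, the Ricci curvature of such a metric on a round unit vector `v` is `(d - 1) +
(d - 2) Hess F(v, v) / F + ΔF / F`. At the pole `x₀ = 1`, `F = 10`, and its Hessian is `0` in the
`x₁` direction and `-6` in all others, so for `v = ∂/∂x₂` the value is `(d - 1) - 6(2d - 3)/10 = (8
- 2d)/10`. This is positive for `d = 3` and negative for `d ≥ 5`: the Laplacian on the whole sphere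
counts orbit directions that the quotient does not see.

Quotient. Regular points are those with `y ≠ 0`, and `(x, y) ↦ (x, |y|)` identifies their quotient
with an open round half of `S³`, rescaled by `F⁻²`. Stereographic projection `x / (1 + |y|)` turns
it into a conformally flat metric on the unit ball of `ℝ³` (`isRegularQuotient_quotMap`), and
`ricciCoord_conformal` with `ball_ricci_bound` bounds its Ricci curvature below, in fact by `20`.

Cheeger deformations. For any biinvariant `Q`, the squared length of the element of `𝔰𝔬(m)` dual to
`U ↦ ⟪a, U y⟫` is `κ` times the squared area spanned by `y` and `a` (`exists_momentSq_eq`), although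
`𝔰𝔬(4)` is not simple. So `Q` and `t` matter only through `c = t κ ≥ 0`, and the deformed metric is
induced by the explicit form `ambForm c` (`isCheegerDeformation_cheegerMetric`,
`IsCheegerDeformation.inner_eq`).

Persistence. The pole is fixed by the group, so every tangent vector there is horizontal. The
correction in `ambForm c` is quadratic in `y` and involves only `y`-components, so it contributes
nothing to `Ric(X, X)` for `X = ∂/∂x₂` (`ricciCoord_stereoForm`): the value is `(8 - 2d)/10` for
every `c ≥ 0`. -/

noncomputable section

set_option maxSynthPendingDepth 3

/-! ### Riemannian metrics induced by immersions -/

open Topology Bornology in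
/-- The unit ball of a positive definite form on `ℝᵈ` is bounded. -/
lemma isVonNBounded_of_pos {d : ℕ} (b : Euc d →L[ℝ] Euc d →L[ℝ] ℝ)
    (hb : ∀ v, v ≠ 0 → 0 < b v v) : IsVonNBounded ℝ {v : Euc d | b v v < 1} := by
  rw [NormedSpace.isVonNBounded_iff]
  have hcont : Continuous fun v : Euc d => b v v := by fun_prop
  rcases (sphere (0 : Euc d) 1).eq_empty_or_nonempty with he | hne
  · have hz : ∀ v : Euc d, v = 0 := fun v => by
      by_contra hv
      have : (‖v‖⁻¹ • v) ∈ sphere (0 : Euc d) 1 := by simp [norm_smul, hv]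
      simp [he] at this
    exact (isBounded_singleton (x := (0 : Euc d))).subset fun v _ => hz v
  · obtain ⟨x, hx, hmin⟩ := (isCompact_sphere (0 : Euc d) 1).exists_isMinOn hne hcont.continuousOn
    have hx0 : x ≠ 0 := by
      rintro rfl
      simp at hx
    have hc := hb x hx0
    set c := b x x
    refine (Metric.isBounded_closedBall (x := (0 : Euc d)) (r := 1 + c⁻¹)).subset fun v hv => ?_
    rw [mem_closedBall_zero_iff]
    rcases eq_or_ne v 0 with rfl | hv0
    · simp; positivity
    · have hn : 0 < ‖v‖ := norm_pos_iff.2 hv0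
      have h1 : c ≤ b (‖v‖⁻¹ • v) (‖v‖⁻¹ • v) := hmin (by simp [norm_smul, hn.ne'])
      simp only [map_smul, _root_.smul_apply, smul_eq_mul] at h1
      have h2 : c * ‖v‖ ^ 2 ≤ 1 := by
        have := mul_le_mul_of_nonneg_right h1 (sq_nonneg ‖v‖)
        have h3 : ‖v‖⁻¹ * (‖v‖⁻¹ * b v v) * ‖v‖ ^ 2 = b v v := by field_simp
        have hv' : b v v < 1 := hv
        linarith
      have h4 : ‖v‖ ^ 2 ≤ c⁻¹ := by
        rw [← one_div, le_div_iff₀ hc]; linarith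
      nlinarith [inv_pos.2 hc]

/-- Composing in the second slot is composing the flipped form in the first, so the pull-back is two
compositions and two flips, each of them smooth. -/
lemma contDiff_bilinearComp {V E : Type} [NormedAddCommGroup V] [NormedSpace ℝ V]
    [NormedAddCommGroup E] [NormedSpace ℝ E] :
    ContDiff ℝ ∞ (fun T : (V →L[ℝ] E) × (E →L[ℝ] E →L[ℝ] ℝ) => T.2.bilinearComp T.1 T.1) := by
  have h4 : ContDiff ℝ ∞ (fun T : (V →L[ℝ] E) × (E →L[ℝ] E →L[ℝ] ℝ) => T.2.comp T.1) :=
    contDiff_snd.clm_comp contDiff_fst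
  let L₁ : (V →L[ℝ] E →L[ℝ] ℝ) →L[ℝ] (E →L[ℝ] V →L[ℝ] ℝ) :=
    (ContinuousLinearMap.flipₗᵢ ℝ V E ℝ).toContinuousLinearEquiv.toContinuousLinearMap
  let L₂ : (V →L[ℝ] V →L[ℝ] ℝ) →L[ℝ] (V →L[ℝ] V →L[ℝ] ℝ) :=
    (ContinuousLinearMap.flipₗᵢ ℝ V V ℝ).toContinuousLinearEquiv.toContinuousLinearMap
  have h5 : ContDiff ℝ ∞ (fun T : (V →L[ℝ] E) × (E →L[ℝ] E →L[ℝ] ℝ) => L₁ (T.2.comp T.1)) := by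
    fun_prop
  have h6 : ContDiff ℝ ∞ (fun T : (V →L[ℝ] E) × (E →L[ℝ] E →L[ℝ] ℝ) =>
      L₂ ((L₁ (T.2.comp T.1)).comp T.1)) := by
    fun_prop
  exact h6

lemma contMDiffAt_bilinearComp {d : ℕ} {M V E : Type} [TopologicalSpace M] [ChartedSpace (Euc d) M]
    [NormedAddCommGroup V] [NormedSpace ℝ V] [NormedAddCommGroup E] [NormedSpace ℝ E]
    {D : M → V →L[ℝ] E} {B : M → E →L[ℝ] E →L[ℝ] ℝ} {x : M}
    (hD : ContMDiffAt (𝓡 d) 𝓘(ℝ, V →L[ℝ] E) ∞ D x)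
    (hB : ContMDiffAt (𝓡 d) 𝓘(ℝ, E →L[ℝ] E →L[ℝ] ℝ) ∞ B x) :
    ContMDiffAt (𝓡 d) 𝓘(ℝ, V →L[ℝ] V →L[ℝ] ℝ) ∞ (fun p => (B p).bilinearComp (D p) (D p)) x := by
  have h : ContMDiffAt (𝓡 d) 𝓘(ℝ, (V →L[ℝ] E) × (E →L[ℝ] E →L[ℝ] ℝ)) ∞ (fun p => (D p, B p)) x :=
    hD.prodMk_space hB
  have h' := (contDiff_bilinearComp (V := V) (E := E)).contMDiff.contMDiffAt.comp x h
  exact h'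

section PullbackMetric

variable {d : ℕ} {M : Type} [TopologicalSpace M] [ChartedSpace (Euc d) M] [IsManifold (𝓡 d) ∞ M]
  {E : Type} [NormedAddCommGroup E] [NormedSpace ℝ E]

/-- The pull-back `F^* H` at `p`. -/
def pullbackForm (F : M → E) (H : E → E →L[ℝ] E →L[ℝ] ℝ) (p : M) :
    TangentSpace (𝓡 d) p →L[ℝ] TangentSpace (𝓡 d) p →L[ℝ] ℝ :=
  let D : Euc d →L[ℝ] E := mvfderiv (𝓡 d) F p
  let b : Euc d →L[ℝ] Euc d →L[ℝ] ℝ := (H (F p)).bilinearComp D D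
  b

/-- Read in the trivialization at `x₀`, the section is `H ∘ F` composed twice with the derivative of
`F` in tangent coordinates, and that derivative depends smoothly on the point. -/
lemma contMDiff_pullbackForm {F : M → E} (hF : ContMDiff (𝓡 d) 𝓘(ℝ, E) ∞ F)
    {H : E → E →L[ℝ] E →L[ℝ] ℝ} (hH : ∀ p, ContDiffAt ℝ ∞ H (F p)) :
    ContMDiff (𝓡 d) ((𝓡 d).prod 𝓘(ℝ, Euc d →L[ℝ] Euc d →L[ℝ] ℝ)) ∞
    (fun b : M ↦ Bundle.TotalSpace.mk' (Euc d →L[ℝ] Euc d →L[ℝ] ℝ)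
      b (pullbackForm (d := d) F H b)) := by
  intro x₀
  rw [Bundle.contMDiffAt_section]
  have h1 : ContMDiffAt (𝓡 d) 𝓘(ℝ, Euc d →L[ℝ] E) ∞
      (inTangentCoordinates (𝓡 d) 𝓘(ℝ, E) id F (mfderiv (𝓡 d) 𝓘(ℝ, E) F) x₀) x₀ :=
    (hF x₀).mfderiv_const (by simp)
  have h2 : ContMDiffAt (𝓡 d) 𝓘(ℝ, E →L[ℝ] E →L[ℝ] ℝ) ∞ (fun x => H (F x)) x₀ :=
    (hH x₀).contMDiffAt.comp x₀ (hF x₀)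
  have h3 : ContMDiffAt (𝓡 d) 𝓘(ℝ, Euc d →L[ℝ] Euc d →L[ℝ] ℝ) ∞
      (fun x => (H (F x)).bilinearComp
        (inTangentCoordinates (𝓡 d) 𝓘(ℝ, E) id F (mfderiv (𝓡 d) 𝓘(ℝ, E) F) x₀ x)
        (inTangentCoordinates (𝓡 d) 𝓘(ℝ, E) id F (mfderiv (𝓡 d) 𝓘(ℝ, E) F) x₀ x)) x₀ := by
    exact contMDiffAt_bilinearComp h1 h2
  refine h3.congr_of_eventuallyEq ?_
  have hb := (trivializationAt (Euc d) (TangentSpace (𝓡 d)) x₀).open_baseSet.mem_nhds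
    (FiberBundle.mem_baseSet_trivializationAt' x₀)
  filter_upwards [hb] with x hx
  have key : ∀ v : Euc d, inTangentCoordinates (𝓡 d) 𝓘(ℝ, E) id F (mfderiv (𝓡 d) 𝓘(ℝ, E) F) x₀ x v
      = mvfderiv (𝓡 d) F x ((trivializationAt (Euc d) (TangentSpace (𝓡 d)) x₀).symm x v) := by
    intro v
    change (trivializationAt E (TangentSpace 𝓘(ℝ, E)) (F x₀)).continuousLinearMapAt ℝ (F x)
      (mfderiv (𝓡 d) 𝓘(ℝ, E) F x ((trivializationAt (Euc d) (TangentSpace (𝓡 d)) x₀).symmL ℝ x v))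
      = _
    rw [TangentBundle.continuousLinearMapAt_model_space, Bundle.Trivialization.symmL_apply _ hx]
    rfl
  refine ContinuousLinearMap.ext fun v => ContinuousLinearMap.ext fun w => ?_
  rw [ContinuousLinearMap.bilinearComp_apply, key v, key w]
  refine (inCoordinates_apply_eq₂ (F₁ := Euc d) (F₂ := Euc d) (F₃ := ℝ)
    (E₁ := TangentSpace (𝓡 d)) (E₂ := TangentSpace (𝓡 d)) (E₃ := fun _ : M => ℝ)
    (ϕ := pullbackForm (d := d) F H x) hx hx (by simp)).trans ?_
  simp
  rfl

/-- The Riemannian metric on `M` induced from a field `H` of bilinear forms on `E` by an immersion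
`F : M → E`. -/
def pullbackMetric (F : M → E) (hF : ContMDiff (𝓡 d) 𝓘(ℝ, E) ∞ F) (H : E → E →L[ℝ] E →L[ℝ] ℝ)
    (hH : ∀ p, ContDiffAt ℝ ∞ H (F p)) (hsymm : ∀ p u v, H (F p) u v = H (F p) v u)
    (hpos : ∀ p (v : TangentSpace (𝓡 d) p), v ≠ 0 →
      0 < H (F p) (mvfderiv (𝓡 d) F p v) (mvfderiv (𝓡 d) F p v)) :
    SmoothMetric d M where
  inner p := pullbackForm F H p
  symm p v w := hsymm p _ _
  pos p v hv := hpos p v hv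
  isVonNBounded p := by
    have h : ∀ v : Euc d, v ≠ 0 → 0 < (show Euc d →L[ℝ] Euc d →L[ℝ] ℝ from pullbackForm F H p) v v :=
      hpos p
    exact isVonNBounded_of_pos _ h
  contMDiff := contMDiff_pullbackForm hF hH

end PullbackMetric

/-! ### Ricci curvature of conformally flat metrics -/

section RicciCoord

open Topology Filter
open scoped RealInnerProductSpace

variable {d : ℕ}

/-- The inner product of a Euclidean space as a bilinear form. -/
def dotForm (E : Type) [NormedAddCommGroup E] [InnerProductSpace ℝ E] : E →L[ℝ] E →L[ℝ] ℝ :=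
  innerSL ℝ

@[simp] lemma dotForm_apply {E : Type} [NormedAddCommGroup E] [InnerProductSpace ℝ E] (u v : E) :
    dotForm E u v = ⟪u, v⟫ := rfl

/-- The vector dual to a linear form on `ℝᵈ`. -/
def sharp : (Euc d →L[ℝ] ℝ) →L[ℝ] Euc d :=
  ∑ i, (ContinuousLinearMap.apply ℝ ℝ (EuclideanSpace.single i (1 : ℝ) : Euc d)).smulRight
    (EuclideanSpace.single i (1 : ℝ))

lemma sharp_apply (l : Euc d →L[ℝ] ℝ) (i : Fin d) :
    sharp l i = l (EuclideanSpace.single i 1) := by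
  simp [sharp, Finset.sum_apply, Pi.single_apply]

lemma inner_eq_sum (u v : Euc d) : ⟪u, v⟫ = ∑ i, u i * v i := by
  simp [PiLp.inner_apply, mul_comm]

lemma inner_single_one (u : Euc d) (i : Fin d) : ⟪u, EuclideanSpace.single i (1 : ℝ)⟫ = u i := by
  simp [EuclideanSpace.inner_single_right]

lemma eq_sum_single (u : Euc d) : u = ∑ i, u i • (EuclideanSpace.single i (1 : ℝ) : Euc d) := by
  ext j
  simp [Finset.sum_apply, Pi.single_apply]

lemma inner_sharp (l : Euc d →L[ℝ] ℝ) (v : Euc d) : ⟪sharp l, v⟫ = l v := by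
  conv_rhs => rw [eq_sum_single v]
  simp [inner_eq_sum, sharp_apply, mul_comm]

lemma sharp_dotForm (v : Euc d) : sharp (dotForm (Euc d) v) = v := by
  ext i
  simp [sharp_apply, EuclideanSpace.inner_single_right]

lemma smul_dotForm_comp_sharp {α : ℝ} (hα : α ≠ 0) :
    (α • dotForm (Euc d) : Euc d →L[ℝ] Euc d →L[ℝ] ℝ).comp (α⁻¹ • sharp) = ContinuousLinearMap.id ℝ _ := by
  ext l v
  simp [inner_sharp, hα, -ContinuousLinearMap.coe_id, ContinuousLinearMap.id_apply]

lemma sharp_comp_smul_dotForm {α : ℝ} (hα : α ≠ 0) :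
    (α⁻¹ • sharp : (Euc d →L[ℝ] ℝ) →L[ℝ] Euc d).comp (α • dotForm (Euc d)) = ContinuousLinearMap.id ℝ _ := by
  ext v i
  simp [sharp_dotForm, hα]

lemma inverse_smul_dotForm {α : ℝ} (hα : α ≠ 0) :
    (α • dotForm (Euc d) : Euc d →L[ℝ] Euc d →L[ℝ] ℝ).inverse = α⁻¹ • sharp :=
  ContinuousLinearMap.inverse_eq (smul_dotForm_comp_sharp hα) (sharp_comp_smul_dotForm hα)

lemma isInvertible_smul_dotForm {α : ℝ} (hα : α ≠ 0) :
    (α • dotForm (Euc d) : Euc d →L[ℝ] Euc d →L[ℝ] ℝ).IsInvertible :=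
  ⟨.equivOfInverse (α • dotForm (Euc d)) (α⁻¹ • sharp) (fun v => DFunLike.congr_fun (sharp_comp_smul_dotForm hα) v)
    (fun l => DFunLike.congr_fun (smul_dotForm_comp_sharp hα) l), rfl⟩

/-- The Ricci tensor depends only on the germ of the metric, so the metric in a chart can be
replaced by any expression agreeing with it near the point. -/
lemma ricciCoord_congr {G G' : Euc d → Euc d →L[ℝ] Euc d →L[ℝ] ℝ} {y : Euc d}
    (h : G =ᶠ[𝓝 y] G')
    (v w : Euc d) : ricciCoord G y v w = ricciCoord G' y v w := by
  have hc : ∀ u v : Euc d, (fun z => christoffel G z u v) =ᶠ[𝓝 y] fun z => christoffel G' z u v := by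
    intro u v
    filter_upwards [h, h.fderiv (𝕜 := ℝ)] with z h1 h2
    simp only [christoffel, h1, h2]
  have hc' : ∀ u v : Euc d, christoffel G y u v = christoffel G' y u v := fun u v =>
    (hc u v).eq_of_nhds
  simp only [ricciCoord, curvature, hc', (hc _ _).fderiv_eq]

/-- The Ricci curvature at a point where the Christoffel map has the form it takes for a conformally
flat metric, `Γ(u, v) = ⟨a, u⟩ v + ⟨a, v⟩ u - ⟨u, v⟩ a`. -/
lemma ricciCoord_of_christoffel {G : Euc d → Euc d →L[ℝ] Euc d →L[ℝ] ℝ} {y : Euc d}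
    {a : Euc d → Euc d} {A : Euc d →L[ℝ] Euc d}
    (hG : ∀ u v, ∀ᶠ z in 𝓝 y, christoffel G z u v = ⟪a z, u⟫ • v + ⟪a z, v⟫ • u - ⟪u, v⟫ • a z)
    (ha : HasFDerivAt a A y) (hA : ∀ u v, ⟪A u, v⟫ = ⟪u, A v⟫) (v : Euc d) :
    ricciCoord G y v v = (2 - d) * ⟪A v, v⟫ - (∑ i, A (EuclideanSpace.single i 1) i) * ⟪v, v⟫
      + (d - 2) * (⟪a y, v⟫ ^ 2 - ⟪a y, a y⟫ * ⟪v, v⟫) := by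
  have hc : ∀ u v : Euc d,
      christoffel G y u v = ⟪a y, u⟫ • v + ⟪a y, v⟫ • u - ⟪u, v⟫ • a y :=
    fun u v => (hG u v).self_of_nhds
  have hd : ∀ u v e : Euc d, fderiv ℝ (fun z => christoffel G z u v) y e
      = ⟪A e, u⟫ • v + ⟪A e, v⟫ • u - ⟪u, v⟫ • A e := by
    intro u v e
    have h1 : HasFDerivAt (fun z => ⟪a z, u⟫ • v + ⟪a z, v⟫ • u - ⟪u, v⟫ • a z)
        ((((dotForm (Euc d)).flip u).comp A).smulRight v + (((dotForm (Euc d)).flip v).comp A).smulRight u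
          - ⟪u, v⟫ • A) y := by
      have hi : ∀ u : Euc d, HasFDerivAt (fun z => ⟪a z, u⟫) (((dotForm (Euc d)).flip u).comp A) y :=
        fun u => ((dotForm (Euc d)).flip u).hasFDerivAt.comp y ha
      exact (((hi u).smul_const v).add ((hi v).smul_const u)).sub (ha.const_smul ⟪u, v⟫)
    rw [(Filter.EventuallyEq.fderiv_eq (hG u v)), h1.fderiv]
    simp
  -- Diagonal entries of the curvature operator, arranged so that summing over `i` only produces
  -- inner products, the trace of `A`, and multiples of `d`.
  have hterm : ∀ i : Fin d, curvature G y (EuclideanSpace.single i 1) v v i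
      = (A v i * v i + A v i * v i - ⟪v, v⟫ * A (EuclideanSpace.single i 1) i
        + (2 * ⟪a y, v⟫ ^ 2 - ⟪v, v⟫ * ⟪a y, a y⟫) - ⟪A v, v⟫)
        - (⟪a y, v⟫ ^ 2 + 2 * ⟪a y, v⟫ * (a y i * v i) - ⟪a y, a y⟫ * (v i * v i)
          - ⟪v, v⟫ * (a y i * a y i)) := by
    intro i
    have e1 : ∀ u : Euc d, ⟪(EuclideanSpace.single i (1 : ℝ) : Euc d), u⟫ = u i := fun u => by
      rw [real_inner_comm, inner_single_one]
    simp only [curvature, hc, hd, PiLp.sub_apply, PiLp.add_apply, PiLp.smul_apply, smul_eq_mul,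
      inner_add_right, inner_sub_right, inner_smul_right, inner_single_one, e1, hA,
      PiLp.single_apply, if_true]
    have e2 : ⟪v, A (EuclideanSpace.single i 1)⟫ = A v i := by rw [← hA, inner_single_one]
    rw [real_inner_comm (a y) v, e2, real_inner_comm (A v) v]
    ring
  simp only [ricciCoord, hterm, Finset.sum_add_distrib, Finset.sum_sub_distrib, ← Finset.mul_sum,
    ← inner_eq_sum, Finset.sum_const, Finset.card_univ, Fintype.card_fin, nsmul_eq_mul]
  ring

lemma hasFDerivAt_smul_right {V W : Type} [NormedAddCommGroup V] [NormedSpace ℝ V]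
    [NormedAddCommGroup W] [NormedSpace ℝ W] {f : V → ℝ} {f' : V →L[ℝ] ℝ} {x : V}
    (h : HasFDerivAt f f' x) (c : W) : HasFDerivAt (fun z => f z • c) (f'.smulRight c) x :=
  h.smul_const c

/-- The Ricci curvature of the conformally flat metric `U⁻² ⟨·, ·⟩` on an open subset of `ℝ³`. -/
lemma ricciCoord_conformal {G : Euc 3 → Euc 3 →L[ℝ] Euc 3 →L[ℝ] ℝ} {y : Euc 3}
    {U : Euc 3 → ℝ} {g : Euc 3 → Euc 3} {D : Euc 3 →L[ℝ] Euc 3}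
    (hG : ∀ᶠ z in 𝓝 y, G z = ((U z) ^ 2)⁻¹ • dotForm (Euc 3))
    (hU : ∀ᶠ z in 𝓝 y, HasFDerivAt U (dotForm (Euc 3) (g z)) z)
    (hg : HasFDerivAt g D y) (hD : ∀ u v, ⟪D u, v⟫ = ⟪u, D v⟫) (h0 : U y ≠ 0) (v : Euc 3) :
    ricciCoord G y v v = (U y * ⟪D v, v⟫ + (U y * (∑ i, D (EuclideanSpace.single i 1) i)
      - 2 * ⟪g y, g y⟫) * ⟪v, v⟫) / U y ^ 2 := by
  have hU0 : ∀ᶠ z in 𝓝 y, U z ≠ 0 :=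
    hU.self_of_nhds.continuousAt.eventually_ne h0
  -- The vector `a` of `ricciCoord_of_christoffel` is the gradient of `log U⁻¹`, that is `-U⁻¹ ∇U`.
  have hc : ∀ u v, ∀ᶠ z in 𝓝 y, christoffel G z u v
      = ⟪-(U z)⁻¹ • g z, u⟫ • v + ⟪-(U z)⁻¹ • g z, v⟫ • u - ⟪u, v⟫ • (-(U z)⁻¹ • g z) := by
    intro u v
    filter_upwards [hG, hG.eventually_nhds, hU, hU0] with z h1 h2 h3 h4
    have h5 : HasFDerivAt G ((-(2 * (U z ^ 3)⁻¹) • dotForm (Euc 3) (g z)).smulRight (dotForm (Euc 3))) z := by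
      have h6 : HasFDerivAt (fun z => ((U z) ^ 2)⁻¹) (-(2 * (U z ^ 3)⁻¹) • dotForm (Euc 3) (g z)) z := by
        have := (hasDerivAt_inv (pow_ne_zero 2 h4)).comp_hasFDerivAt z (h3.pow 2)
        refine this.congr_fderiv ?_
        ext w
        simp
        field_simp
      exact (hasFDerivAt_smul_right h6 (dotForm (Euc 3))).congr_of_eventuallyEq h2
    have hU2 : U z ^ 2 ≠ 0 := pow_ne_zero 2 h4
    rw [christoffel, h5.fderiv, h1, inverse_smul_dotForm (inv_ne_zero hU2)]
    ext i
    simp [sharp_apply, inner_single_one, real_inner_smul_left]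
    field_simp
  have hU1 := hU.self_of_nhds
  have ha : HasFDerivAt (fun z => -(U z)⁻¹ • g z)
      (-(U y)⁻¹ • D + ((U y ^ 2)⁻¹ • dotForm (Euc 3) (g y)).smulRight (g y)) y := by
    have h7 : HasFDerivAt (fun z => -(U z)⁻¹) ((U y ^ 2)⁻¹ • dotForm (Euc 3) (g y)) y := by
      refine ((hasDerivAt_inv h0).comp_hasFDerivAt y hU1).neg.congr_fderiv ?_
      ext w
      simp
    exact h7.smul hg
  rw [ricciCoord_of_christoffel hc ha]
  · have hs : ∑ i, g y i * g y i = ⟪g y, g y⟫ := (inner_eq_sum _ _).symm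
    simp only [_root_.add_apply, _root_.smul_apply,
      ContinuousLinearMap.smulRight_apply, dotForm_apply, inner_add_left, inner_smul_left,
      inner_smul_right, PiLp.add_apply, PiLp.smul_apply, smul_eq_mul, Finset.sum_add_distrib,
      ← Finset.mul_sum, mul_assoc, inner_single_one, hs]
    simp
    field_simp
    ring
  · intro u w
    simp only [_root_.add_apply, _root_.smul_apply,
      ContinuousLinearMap.smulRight_apply, dotForm_apply, inner_add_left, inner_smul_left,
      inner_add_right, inner_smul_right, hD, real_inner_comm (g y) u]
    simp
    ring

end RicciCoord

/-! ### Ricci curvature where the metric is critical -/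

section RicciCritical

open Topology Filter
open scoped RealInnerProductSpace

variable {d : ℕ}

/-- The first Christoffel symbols as a linear function of the first derivative `T` of the metric. -/
def christoffelLower (u v : Euc d) :
    (Euc d →L[ℝ] Euc d →L[ℝ] Euc d →L[ℝ] ℝ) →L[ℝ] (Euc d →L[ℝ] ℝ) :=
  LinearMap.toContinuousLinearMap
    { toFun := fun T => (1 / 2 : ℝ) • (T u v + T v u - (T.flip u).flip v)
      map_add' := fun S T => by ext w; simp; ring
      map_smul' := fun c T => by ext w; simp; ring }

lemma christoffelLower_apply (u v : Euc d) (T : Euc d →L[ℝ] Euc d →L[ℝ] Euc d →L[ℝ] ℝ) :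
    christoffelLower u v T = (1 / 2 : ℝ) • (T u v + T v u - (T.flip u).flip v) := rfl

/-- In the product rule the derivative of `L` is applied to `a x = 0`. With `L` the inverse metric,
this avoids computing the derivative of an inverse. -/
lemma hasFDerivAt_clm_apply_of_eq_zero {V W X : Type} [NormedAddCommGroup V] [NormedSpace ℝ V]
    [NormedAddCommGroup W] [NormedSpace ℝ W] [NormedAddCommGroup X] [NormedSpace ℝ X]
    {L : V → W →L[ℝ] X} {a : V → W} {a' : V →L[ℝ] W} {x : V} (hL : DifferentiableAt ℝ L x)
    (ha : HasFDerivAt a a' x) (h0 : a x = 0) :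
    HasFDerivAt (fun z => L z (a z)) ((L x).comp a') x := by
  refine (hL.hasFDerivAt.clm_apply ha).congr_fderiv ?_
  ext v
  simp [h0]

lemma differentiableAt_inverse_clm {V W X : Type} [NormedAddCommGroup V] [NormedSpace ℝ V]
    [NormedAddCommGroup W] [NormedSpace ℝ W] [CompleteSpace W]
    [NormedAddCommGroup X] [NormedSpace ℝ X]
    {L : V → W →L[ℝ] X} {x : V} (hL : DifferentiableAt ℝ L x) (h : (L x).IsInvertible) :
    DifferentiableAt ℝ (fun z => (L z).inverse) x :=
  ((h.contDiffAt_map_inverse (𝕜 := ℝ) (n := 1)).differentiableAt (by simp)).comp x hL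

/-- The Ricci curvature at a point where the first derivatives of the metric vanish. -/
lemma ricciCoord_of_fderiv_eq_zero {G : Euc d → Euc d →L[ℝ] Euc d →L[ℝ] ℝ} {y : Euc d} {α : ℝ}
    {D₂ : Euc d →L[ℝ] Euc d →L[ℝ] Euc d →L[ℝ] Euc d →L[ℝ] ℝ}
    (hα : α ≠ 0) (hG : DifferentiableAt ℝ G y) (h0 : G y = α • dotForm (Euc d))
    (h1 : fderiv ℝ G y = 0) (h2 : HasFDerivAt (fderiv ℝ G) D₂ y)
    (hs : ∀ e f u v, D₂ e f u v = D₂ e f v u) (v : Euc d) :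
    ricciCoord G y v v = (2 * α)⁻¹ * ∑ i,
      (2 * D₂ (EuclideanSpace.single i 1) v v (EuclideanSpace.single i 1)
        - D₂ (EuclideanSpace.single i 1) (EuclideanSpace.single i 1) v v
        - D₂ v v (EuclideanSpace.single i 1) (EuclideanSpace.single i 1)) := by
  have hc : ∀ u v : Euc d, christoffel G y u v = 0 := by
    intro u v
    have h3 : christoffelLower u v (fderiv ℝ G y) = 0 := by rw [h1, map_zero]
    rw [christoffel, ← christoffelLower_apply, h3, map_zero]
  have hi : DifferentiableAt ℝ (fun z => (G z).inverse) y :=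
    differentiableAt_inverse_clm hG (h0 ▸ isInvertible_smul_dotForm hα)
  have hd : ∀ u v e : Euc d, fderiv ℝ (fun z => christoffel G z u v) y e
      = α⁻¹ • sharp (christoffelLower u v (D₂ e)) := by
    intro u v e
    have h4 : HasFDerivAt (fun z => christoffelLower u v (fderiv ℝ G z))
        ((christoffelLower u v).comp D₂) y :=
      (christoffelLower u v).hasFDerivAt.comp y h2
    have h5 := hasFDerivAt_clm_apply_of_eq_zero hi h4 (by rw [h1, map_zero])
    rw [h0, inverse_smul_dotForm hα] at h5
    have h6 : (fun z => christoffel G z u v)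
      = fun z => (G z).inverse (christoffelLower u v (fderiv ℝ G z)) := rfl
    rw [h6, h5.fderiv]
    rfl
  rw [ricciCoord, Finset.mul_sum]
  refine Finset.sum_congr rfl fun i _ => ?_
  simp only [curvature, hc, hd, add_zero, PiLp.sub_apply, PiLp.smul_apply, sharp_apply,
    christoffelLower_apply, smul_eq_mul, _root_.smul_apply, _root_.add_apply,
    _root_.sub_apply, ContinuousLinearMap.flip_apply]
  -- Of the three terms of `∇_v ∇_{e_i} v`, the two with mixed derivatives along `v` and `e_i`
  -- cancel by symmetry of the metric.
  rw [hs v (EuclideanSpace.single i 1) v]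
  field_simp
  ring

end RicciCritical

/-! ### Ricci curvature through a local parametrization -/

section RicciPullback

open Topology

variable {d : ℕ} {M : Type} [TopologicalSpace M] [ChartedSpace (Euc d) M] [IsManifold (𝓡 d) ∞ M]
  {E : Type} [NormedAddCommGroup E] [NormedSpace ℝ E]

/-- The Ricci curvature of an induced metric, computed with the local parametrization
`F ∘ φ⁻¹` of the image. -/
lemma ricci_eq_ricciCoord {F : M → E} (hF : ContMDiff (𝓡 d) 𝓘(ℝ, E) ∞ F)
    {H : E → E →L[ℝ] E →L[ℝ] ℝ} {g : SmoothMetric d M}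
    (hg : ∀ p u v, g.inner p u v = H (F p) (mvfderiv (𝓡 d) F p u) (mvfderiv (𝓡 d) F p v))
    (p : M) {Φ : Euc d → E} (hΦ : F ∘ (extChartAt (𝓡 d) p).symm =ᶠ[𝓝 (extChartAt (𝓡 d) p p)] Φ)
    (v w : TangentSpace (𝓡 d) p) :
    ricci g p v w = ricciCoord (fun y => (H (Φ y)).bilinearComp (fderiv ℝ Φ y) (fderiv ℝ Φ y))
      (extChartAt (𝓡 d) p p) v w := by
  refine ricciCoord_congr ?_ v w
  have ht : (extChartAt (𝓡 d) p).target ∈ 𝓝 (extChartAt (𝓡 d) p p) := extChartAt_target_mem_nhds p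
  have hΦ' : ∀ᶠ y in 𝓝 (extChartAt (𝓡 d) p p),
      F ∘ (extChartAt (𝓡 d) p).symm =ᶠ[𝓝 y] Φ := hΦ.eventually_nhds
  filter_upwards [eventually_mem_nhds_iff.2 ht, hΦ'] with y hy hy'
  have hs : MDifferentiableAt (𝓡 d) (𝓡 d) (extChartAt (𝓡 d) p).symm y :=
    ((contMDiffOn_extChartAt_symm (n := ∞) p).contMDiffAt hy).mdifferentiableAt (by simp)
  have hF' : MDifferentiableAt (𝓡 d) 𝓘(ℝ, E) F ((extChartAt (𝓡 d) p).symm y) :=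
    (hF _).mdifferentiableAt (by simp)
  have hcomp : ∀ u : Euc d, fderiv ℝ Φ y u = mvfderiv (𝓡 d) F ((extChartAt (𝓡 d) p).symm y)
      (mfderiv (𝓡 d) (𝓡 d) (extChartAt (𝓡 d) p).symm y u) := by
    intro u
    rw [← hy'.fderiv_eq, ← mfderiv_eq_fderiv, mfderiv_comp y hF' hs]
    rfl
  refine ContinuousLinearMap.ext fun u => ContinuousLinearMap.ext fun w => ?_
  rw [metricInChart_apply, hg, ContinuousLinearMap.bilinearComp_apply, hcomp, hcomp,
    ← hy'.eq_of_nhds]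
  rfl

end RicciPullback

/-! ### The sphere in `ℝ³ × ℝᵐ`, its tangent spaces and the block action -/

section Ambient

open scoped RealInnerProductSpace

variable {m : ℕ}

/-- The projection of `ℝ³ × ℝᵐ` to the fixed factor `ℝ³`. -/
def xPart : Amb m →L[ℝ] Euc 3 :=
  LinearMap.toContinuousLinearMap
    { toFun := fun q => WithLp.toLp 2 fun i => q (Sum.inl i)
      map_add' := fun _ _ => rfl
      map_smul' := fun _ _ => rfl }

/-- The projection of `ℝ³ × ℝᵐ` to the factor `ℝᵐ` on which `SO(m)` acts. -/
def yPart : Amb m →L[ℝ] Euc m :=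
  LinearMap.toContinuousLinearMap
    { toFun := fun q => WithLp.toLp 2 fun i => q (Sum.inr i)
      map_add' := fun _ _ => rfl
      map_smul' := fun _ _ => rfl }

/-- The point `(x, y)` of `ℝ³ × ℝᵐ`. -/
def pairAmb (x : Euc 3) (y : Euc m) : Amb m := WithLp.toLp 2 (Sum.elim x y)

@[simp] lemma xPart_pairAmb (x : Euc 3) (y : Euc m) : xPart (pairAmb x y) = x := rfl

@[simp] lemma yPart_pairAmb (x : Euc 3) (y : Euc m) : yPart (pairAmb x y) = y := rfl

lemma amb_ext {p q : Amb m} (hx : xPart p = xPart q) (hy : yPart p = yPart q) : p = q := by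
  ext (i | i)
  · exact congrArg (fun x : Euc 3 => x i) hx
  · exact congrArg (fun y : Euc m => y i) hy

lemma inner_amb (p q : Amb m) : ⟪p, q⟫ = ⟪xPart p, xPart q⟫ + ⟪yPart p, yPart q⟫ := by
  simp only [PiLp.inner_apply, Fintype.sum_sum_type]
  rfl

lemma norm_sq_amb (p : Amb m) : ‖p‖ ^ 2 = ‖xPart p‖ ^ 2 + ‖yPart p‖ ^ 2 := by
  simp only [← real_inner_self_eq_norm_sq, inner_amb]

lemma norm_sq_sph (p : Sph m) : ‖xPart (p : Amb m)‖ ^ 2 + ‖yPart (p : Amb m)‖ ^ 2 = 1 := by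
  rw [← norm_sq_amb, norm_eq_of_mem_sphere, one_pow]

/-- The linear map of `ℝᵐ` given by a matrix. -/
abbrev rot (A : Matrix (Fin m) (Fin m) ℝ) : Euc m →L[ℝ] Euc m :=
  Matrix.toEuclideanCLM (n := Fin m) (𝕜 := ℝ) A

lemma rot_mul (A B : Matrix (Fin m) (Fin m) ℝ) (y : Euc m) : rot (A * B) y = rot A (rot B y) := by
  simp [rot]

lemma inner_rot (A : Matrix (Fin m) (Fin m) ℝ) (u v : Euc m) : ⟪rot A u, v⟫ = ⟪u, rot Aᵀ v⟫ := by
  rw [← ContinuousLinearMap.adjoint_inner_right, ← ContinuousLinearMap.star_eq_adjoint, rot,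
    ← map_star, Matrix.star_eq_conjTranspose, Matrix.conjTranspose_eq_transpose_of_trivial]

lemma inner_rot_rot (A : SO m) (u v : Euc m) : ⟪rot A.1 u, rot A.1 v⟫ = ⟪u, v⟫ := by
  rw [inner_rot, ← rot_mul, SO_transpose_mul]
  simp [rot]

lemma norm_rot (A : SO m) (u : Euc m) : ‖rot A.1 u‖ = ‖u‖ := by
  rw [← sq_eq_sq₀ (norm_nonneg _) (norm_nonneg _), ← real_inner_self_eq_norm_sq,
    ← real_inner_self_eq_norm_sq, inner_rot_rot]

/-- The block action as a continuous linear map. -/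
def blockCLM (A : Matrix (Fin m) (Fin m) ℝ) : Amb m →L[ℝ] Amb m :=
  Matrix.toEuclideanCLM (n := Fin 3 ⊕ Fin m) (𝕜 := ℝ) (Matrix.fromBlocks 1 0 0 A)

lemma blockCLM_apply (A : Matrix (Fin m) (Fin m) ℝ) (q : Amb m) : blockCLM A q = blockAct A q := rfl

lemma xPart_blockAct (A : Matrix (Fin m) (Fin m) ℝ) (q : Amb m) :
    xPart (blockAct A q) = xPart q := by
  ext i
  change (Matrix.fromBlocks 1 0 0 A *ᵥ q.ofLp) (Sum.inl i) = q (Sum.inl i)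
  simp [Matrix.fromBlocks_mulVec]

lemma yPart_blockAct (A : Matrix (Fin m) (Fin m) ℝ) (q : Amb m) :
    yPart (blockAct A q) = rot A (yPart q) := by
  ext i
  change (Matrix.fromBlocks 1 0 0 A *ᵥ q.ofLp) (Sum.inr i) = (A *ᵥ _) i
  simp [Matrix.fromBlocks_mulVec]
  rfl

lemma coe_smul_sph (A : SO m) (p : Sph m) : ((A • p : Sph m) : Amb m) = blockAct A.1 p.1 := rfl

/-- The differential at `p` of the inclusion of the sphere. -/
def sphIncl (p : Sph m) : TangentSpace (𝓡 (m + 2)) p →L[ℝ] Amb m :=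
  mvfderiv (𝓡 (m + 2)) ((↑) : Sph m → Amb m) p

lemma sphIncl_injective (p : Sph m) : Function.Injective (sphIncl p) :=
  injective_mvfderiv_subtypeVal_sphere p

lemma inner_sphIncl (p : Sph m) (v : TangentSpace (𝓡 (m + 2)) p) : ⟪(p : Amb m), sphIncl p v⟫ = 0 := by
  have h : sphIncl p v ∈ (mvfderiv (𝓡 (m + 2)) ((↑) : Sph m → Amb m) p).range := ⟨v, rfl⟩
  rw [range_mvfderiv_subtypeVal] at h
  exact Submodule.mem_orthogonal_singleton_iff_inner_right.1 h

lemma exists_sphIncl_eq (p : Sph m) {w : Amb m} (hw : ⟪(p : Amb m), w⟫ = 0) :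
    ∃ v : TangentSpace (𝓡 (m + 2)) p, sphIncl p v = w := by
  have h : w ∈ (mvfderiv (𝓡 (m + 2)) ((↑) : Sph m → Amb m) p).range := by
    rw [range_mvfderiv_subtypeVal]
    exact Submodule.mem_orthogonal_singleton_iff_inner_right.2 hw
  exact h

lemma hasMFDerivAt_coe_sph (p : Sph m) :
    HasMFDerivAt (𝓡 (m + 2)) 𝓘(ℝ, Amb m) ((↑) : Sph m → Amb m) p (sphIncl p) :=
  ((contMDiff_coe_sphere (m := 1) p).mdifferentiableAt (by simp)).hasMFDerivAt

lemma contMDiff_smul_sph (A : SO m) : ContMDiff (𝓡 (m + 2)) (𝓡 (m + 2)) ∞ fun q : Sph m => A • q :=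
  ContMDiff.codRestrict_sphere (f := fun q : Sph m => blockCLM A.1 (q : Amb m))
    ((blockCLM A.1).contMDiff.comp contMDiff_coe_sphere) fun q => (A • q).2

/-- The inclusion intertwines the action with a linear map; differentiate this identity. -/
lemma sphIncl_dAct (A : SO m) (p : Sph m) (v : TangentSpace (𝓡 (m + 2)) p) :
    sphIncl (A • p) (dAct A p v) = blockAct A.1 (sphIncl p v) := by
  have h1 : HasMFDerivAt (𝓡 (m + 2)) (𝓡 (m + 2)) (fun q : Sph m => A • q) p _ :=
    ((contMDiff_smul_sph A p).mdifferentiableAt (by simp)).hasMFDerivAt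
  have h2 := (hasMFDerivAt_coe_sph (A • p)).comp p h1
  have h3 := (blockCLM A.1).hasMFDerivAt.comp p (hasMFDerivAt_coe_sph p)
  have h4 := hasMFDerivAt_unique h2 h3
  exact DFunLike.congr_fun h4 v

end Ambient

/-! ### Action fields -/

section ActionField

open scoped RealInnerProductSpace

variable {m : ℕ}

/-- Evaluation of the linear map of a matrix at a vector, as a linear function of the matrix. -/
def rotEval (y : Euc m) : Matrix (Fin m) (Fin m) ℝ →ₗ[ℝ] Euc m where
  toFun A := rot A y
  map_add' A B := by simp [rot]
  map_smul' c A := by simp [rot]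

section

open scoped Matrix.Norms.Operator

lemma hasDerivAt_rot_exp (U : Matrix (Fin m) (Fin m) ℝ) (y : Euc m) (s : ℝ) :
    HasDerivAt (fun s : ℝ => rot (NormedSpace.exp (s • U)) y)
      (rot (NormedSpace.exp (s • U)) (rot U y)) s := by
  have h1 : HasDerivAt (fun s : ℝ => NormedSpace.exp (s • U))
    (NormedSpace.exp (s • U) * U) s := hasDerivAt_exp_smul_const U s
  have h2 := (LinearMap.toContinuousLinearMap (rotEval y)).hasFDerivAt.comp_hasDerivAt s h1
  rw [← rot_mul]
  exact h2

end

lemma contDiff_rot_exp (U : Matrix (Fin m) (Fin m) ℝ) (y : Euc m) :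
    ContDiff ℝ 1 (fun s : ℝ => rot (NormedSpace.exp (s • U)) y) := by
  rw [contDiff_one_iff_deriv, funext fun s => (hasDerivAt_rot_exp U y s).deriv]
  exact ⟨fun s => (hasDerivAt_rot_exp U y s).differentiableAt,
    continuous_iff_continuousAt.2 fun s => (hasDerivAt_rot_exp U _ s).continuousAt⟩

/-- The inclusion `y ↦ (0, y)` of `ℝᵐ` in `ℝ³ × ℝᵐ`. -/
def inrAmb : Euc m →L[ℝ] Amb m :=
  LinearMap.toContinuousLinearMap
    { toFun := fun y => pairAmb 0 y
      map_add' := fun _ _ => amb_ext (by simp) (by simp)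
      map_smul' := fun _ _ => amb_ext (by simp) (by simp) }

@[simp] lemma inrAmb_apply (y : Euc m) : inrAmb y = pairAmb 0 y := rfl

lemma sphIncl_actionField (U : LieSO m) (p : Sph m) :
    sphIncl p (actionField U p) = pairAmb 0 (rot U.1 (yPart (p : Amb m))) := by
  have hcurve : ∀ s : ℝ, ((expSO (s • U) • p : Sph m) : Amb m)
      = pairAmb (xPart p.1) 0 + inrAmb (rot (NormedSpace.exp (s • U.1)) (yPart p.1)) := by
    intro s
    rw [coe_smul_sph]
    refine amb_ext ?_ ?_
    · rw [xPart_blockAct]; simp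
    · rw [yPart_blockAct, map_add]; simp [expSO]
  have hsm : ContMDiff 𝓘(ℝ, ℝ) (𝓡 (m + 2)) 1 (fun s : ℝ => expSO (s • U) • p) := by
    refine ContMDiff.codRestrict_sphere (f := fun s : ℝ => ((expSO (s • U) • p : Sph m) : Amb m))
      ?_ fun s => (expSO (s • U) • p : Sph m).2
    simp_rw [hcurve]
    exact (contDiff_const.add (inrAmb.contDiff.comp (contDiff_rot_exp U.1 _))).contMDiff
  have h0 : expSO ((0 : ℝ) • U) • p = p := by
    refine Subtype.ext ?_
    rw [hcurve]
    exact amb_ext (by simp) (by simp)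
  have h1 : HasMFDerivAt 𝓘(ℝ, ℝ) (𝓡 (m + 2)) (fun s : ℝ => expSO (s • U) • p) 0 _ :=
    ((hsm 0).mdifferentiableAt (by simp)).hasMFDerivAt
  have h2 : HasMFDerivAt (𝓡 (m + 2)) 𝓘(ℝ, Amb m) ((↑) : Sph m → Amb m)
      (expSO ((0 : ℝ) • U) • p) (sphIncl (expSO ((0 : ℝ) • U) • p)) := hasMFDerivAt_coe_sph _
  have h3 := h2.comp (0 : ℝ) h1
  have h4 : HasFDerivAt (fun s : ℝ => ((expSO (s • U) • p : Sph m) : Amb m))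
      (ContinuousLinearMap.toSpanSingleton ℝ (inrAmb (rot U.1 (yPart p.1)))) 0 := by
    simp_rw [hcurve]
    have h5 := (inrAmb (m := m)).hasFDerivAt.comp_hasDerivAt (0 : ℝ)
      (hasDerivAt_rot_exp U.1 (yPart p.1) 0)
    rw [zero_smul, NormedSpace.exp_zero] at h5
    simp only [map_one, one_apply_eq_self] at h5
    exact (h5.const_add _).hasFDerivAt
  have h6 := DFunLike.congr_fun (hasMFDerivAt_unique h3 h4.hasMFDerivAt) (1 : ℝ)
  -- The curve starts at `expSO (0 • U) • p`, which equals `p` only propositionally; `h7` transports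
  -- the differential of the inclusion along this equality.
  have h7 : ∀ q : Sph m, q = p → ∀ v : Euc (m + 2),
      (show Euc (m + 2) →L[ℝ] Amb m from sphIncl q) v = sphIncl p v := by
    rintro _ rfl _
    rfl
  have h8 := (h7 _ h0 (actionField U p)).symm.trans h6
  exact h8.trans (one_smul ℝ _)

end ActionField

/-! ### The metric and its explicit deformations -/

section DeformedMetric

open scoped RealInnerProductSpace

variable {m : ℕ}

/-- The conformal factor of the metric. -/
def confFactor (x : Euc 3) : ℝ := ((7 + 3 * (x 0 ^ 2 + x 1 ^ 2)) ^ 2)⁻¹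

lemma confFactor_pos (x : Euc 3) : 0 < confFactor x := by
  unfold confFactor
  positivity

/-- The coefficient of the vertical correction in the Cheeger deformation. -/
def cheegerCoeff (c e r : ℝ) : ℝ := c * e / (1 + c * e * r)

/-- The form `|y|² ⟨u, v⟩ - ⟨y, u⟩ ⟨y, v⟩` of the action of rotations. -/
def orbitForm (y : Euc m) : Euc m →L[ℝ] Euc m →L[ℝ] ℝ :=
  ‖y‖ ^ 2 • dotForm (Euc m) - (dotForm (Euc m) y).smulRight (dotForm (Euc m) y)

lemma orbitForm_apply (y u v : Euc m) :
    orbitForm y u v = ‖y‖ ^ 2 * ⟪u, v⟫ - ⟪y, u⟫ * ⟪y, v⟫ := by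
  simp [orbitForm]

lemma orbitForm_self_le (y u : Euc m) : orbitForm y u u ≤ ‖y‖ ^ 2 * ‖u‖ ^ 2 := by
  rw [orbitForm_apply, real_inner_self_eq_norm_sq]
  nlinarith [mul_self_nonneg ⟪y, u⟫]

/-- The bilinear forms on `ℝ³ × ℝᵐ` which induce the Cheeger deformations on the sphere. -/
def ambForm (c : ℝ) (q : Amb m) : Amb m →L[ℝ] Amb m →L[ℝ] ℝ :=
  confFactor (xPart q) • (dotForm (Amb m) -
    cheegerCoeff c (confFactor (xPart q)) (‖yPart q‖ ^ 2) •
      (orbitForm (yPart q)).bilinearComp yPart yPart)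

lemma ambForm_apply (c : ℝ) (q u v : Amb m) :
    ambForm c q u v = confFactor (xPart q) * (⟪u, v⟫ -
      cheegerCoeff c (confFactor (xPart q)) (‖yPart q‖ ^ 2) *
        orbitForm (yPart q) (yPart u) (yPart v)) := by
  simp [ambForm]

lemma contDiff_confFactor : ContDiff ℝ ∞ confFactor := by
  unfold confFactor
  refine ContDiff.inv (by fun_prop) fun x => by positivity

lemma cheegerCoeff_denom_pos {c : ℝ} (hc : 0 ≤ c) (q : Amb m) :
    0 < 1 + c * confFactor (xPart q) * ‖yPart q‖ ^ 2 := by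
  have := confFactor_pos (xPart q)
  positivity

lemma contDiff_orbitForm : ContDiff ℝ ∞ (orbitForm : Euc m → _) := by
  unfold orbitForm
  refine ContDiff.sub ?_ ?_
  · exact (contDiff_norm_sq ℝ).smul contDiff_const
  · exact (dotForm (Euc m)).contDiff.smulRight (dotForm (Euc m)).contDiff

lemma contDiff_orbitForm_yPart :
    ContDiff ℝ ∞ fun q : Amb m => (orbitForm (yPart q)).bilinearComp yPart yPart := by
  have h : ContDiff ℝ ∞ fun q : Amb m => orbitForm (yPart q) :=
    contDiff_orbitForm.comp yPart.contDiff
  have h' : ContDiff ℝ ∞ fun q : Amb m => ((yPart : Amb m →L[ℝ] Euc m), orbitForm (yPart q)) :=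
    contDiff_const.prodMk h
  have h'' := (contDiff_bilinearComp (V := Amb m) (E := Euc m)).comp h'
  exact h''

lemma contDiff_cheegerCoeff {c : ℝ} (hc : 0 ≤ c) : ContDiff ℝ ∞ fun q : Amb m =>
    cheegerCoeff c (confFactor (xPart q)) (‖yPart q‖ ^ 2) := by
  have h1 : ContDiff ℝ ∞ fun q : Amb m => confFactor (xPart q) :=
    contDiff_confFactor.comp xPart.contDiff
  have h2 : ContDiff ℝ ∞ fun q : Amb m => ‖yPart q‖ ^ 2 :=
    (contDiff_norm_sq ℝ).comp yPart.contDiff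
  unfold cheegerCoeff
  exact (contDiff_const.mul h1).div (contDiff_const.add ((contDiff_const.mul h1).mul h2))
    fun q => (cheegerCoeff_denom_pos hc q).ne'

lemma contDiff_ambForm {c : ℝ} (hc : 0 ≤ c) : ContDiff ℝ ∞ (ambForm c : Amb m → _) := by
  have h1 : ContDiff ℝ ∞ fun q : Amb m => confFactor (xPart q) :=
    contDiff_confFactor.comp xPart.contDiff
  have h3 := contDiff_cheegerCoeff (m := m) hc
  have h4 : ContDiff ℝ ∞ fun q : Amb m => (orbitForm (yPart q)).bilinearComp yPart yPart :=
    contDiff_orbitForm_yPart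
  unfold ambForm
  fun_prop

lemma ambForm_symm (c : ℝ) (q u v : Amb m) : ambForm c q u v = ambForm c q v u := by
  rw [ambForm_apply, ambForm_apply, orbitForm_apply, orbitForm_apply, real_inner_comm u v,
    real_inner_comm (yPart u) (yPart v)]
  ring

/-- With `τ` the product of `c` and the conformal factor and `r = |y|`, the correction removes at
most the fraction `τ r² / (1 + τ r²) < 1` of `|u|²`. -/
lemma ambForm_pos {c : ℝ} (hc : 0 ≤ c) (q : Amb m) {u : Amb m} (hu : u ≠ 0) :
    0 < ambForm c q u u := by
  rw [ambForm_apply]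
  have he := confFactor_pos (xPart q)
  have hd := cheegerCoeff_denom_pos hc q
  refine mul_pos he ?_
  have hτ : 0 ≤ c * confFactor (xPart q) := by positivity
  have hu2 : 0 < ‖u‖ ^ 2 := by positivity
  rw [real_inner_self_eq_norm_sq, cheegerCoeff, sub_pos, div_mul_eq_mul_div, div_lt_iff₀ hd]
  have h1 := mul_le_mul_of_nonneg_left (orbitForm_self_le (yPart q) (yPart u)) hτ
  have h2 : ‖yPart u‖ ^ 2 ≤ ‖u‖ ^ 2 := by
    rw [norm_sq_amb]
    nlinarith [sq_nonneg ‖xPart u‖]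
  have h3 : c * confFactor (xPart q) * (‖yPart q‖ ^ 2 * ‖yPart u‖ ^ 2)
      ≤ c * confFactor (xPart q) * (‖yPart q‖ ^ 2 * ‖u‖ ^ 2) := by gcongr
  nlinarith

lemma sphIncl_ne_zero {p : Sph m} {v : TangentSpace (𝓡 (m + 2)) p} (hv : v ≠ 0) :
    sphIncl p v ≠ 0 := fun h => hv (sphIncl_injective p (by rw [h, map_zero]))

/-- The metrics on the sphere induced by `ambForm c`. -/
def cheegerMetric (m : ℕ) {c : ℝ} (hc : 0 ≤ c) : SphMetric m :=
  pullbackMetric ((↑) : Sph m → Amb m) contMDiff_coe_sphere (ambForm c)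
    (fun _ => (contDiff_ambForm hc).contDiffAt) (fun _ _ _ => ambForm_symm _ _ _ _)
    fun p _ hv => ambForm_pos hc p.1 (sphIncl_ne_zero hv)

lemma cheegerMetric_inner {c : ℝ} (hc : 0 ≤ c) (p : Sph m) (u v : TangentSpace (𝓡 (m + 2)) p) :
    (cheegerMetric m hc).inner p u v = ambForm c p.1 (sphIncl p u) (sphIncl p v) := rfl

lemma inner_blockAct (A : SO m) (u v : Amb m) :
    ⟪blockAct A.1 u, blockAct A.1 v⟫ = ⟪u, v⟫ := by
  rw [inner_amb, inner_amb, xPart_blockAct, xPart_blockAct, yPart_blockAct, yPart_blockAct,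
    inner_rot_rot]

lemma ambForm_blockAct (c : ℝ) (A : SO m) (q u v : Amb m) :
    ambForm c (blockAct A.1 q) (blockAct A.1 u) (blockAct A.1 v) = ambForm c q u v := by
  simp only [ambForm_apply, orbitForm_apply, inner_blockAct, xPart_blockAct,
    yPart_blockAct, inner_rot_rot, norm_rot]

lemma cheegerMetric_invariant {c : ℝ} (hc : 0 ≤ c) : IsSOInvariant (cheegerMetric m hc) := by
  intro A p u v
  rw [cheegerMetric_inner, cheegerMetric_inner, sphIncl_dAct, sphIncl_dAct, coe_smul_sph,
    ambForm_blockAct]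

end DeformedMetric

/-! ### Rotations as products of two reflections -/

section Rotations

open scoped RealInnerProductSpace

variable {m : ℕ}

/-- The matrix of the reflection in the hyperplane orthogonal to the unit vector `v`. -/
def reflMatrix (v : Euc m) : Matrix (Fin m) (Fin m) ℝ :=
  1 + Matrix.vecMulVec (-(2 : ℝ) • v.ofLp) v.ofLp

lemma rot_reflMatrix (v y : Euc m) : rot (reflMatrix v) y = y - (2 * ⟪v, y⟫) • v := by
  ext i
  change (reflMatrix v *ᵥ y.ofLp) i = _
  rw [reflMatrix, Matrix.add_mulVec]
  simp only [Matrix.one_mulVec, Pi.add_apply, Matrix.mulVec, dotProduct, Matrix.vecMulVec_apply,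
    Pi.smul_apply, smul_eq_mul, inner_eq_sum, PiLp.sub_apply, PiLp.smul_apply, mul_assoc,
    ← Finset.mul_sum]
  ring

lemma transpose_reflMatrix (v : Euc m) : (reflMatrix v)ᵀ = reflMatrix v := by
  ext i j
  simp only [reflMatrix, Matrix.transpose_apply, Matrix.add_apply, Matrix.one_apply, eq_comm,
    Matrix.vecMulVec_apply, Pi.smul_apply, smul_eq_mul]
  ring

lemma det_reflMatrix {v : Euc m} (hv : ‖v‖ = 1) : (reflMatrix v).det = -1 := by
  have h : v.ofLp ⬝ᵥ v.ofLp = 1 := by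
    have := inner_eq_sum v v
    rw [real_inner_self_eq_norm_sq, hv] at this
    simpa [dotProduct] using this.symm
  rw [reflMatrix, Matrix.vecMulVec_eq (Fin 1), Matrix.det_one_add_replicateCol_mul_replicateRow,
    dotProduct_smul, h]
  norm_num

lemma reflMatrix_mul_self {v : Euc m} (hv : ‖v‖ = 1) : reflMatrix v * reflMatrix v = 1 := by
  refine (Matrix.toEuclideanCLM (n := Fin m) (𝕜 := ℝ)).injective ?_
  refine ContinuousLinearMap.ext fun y => ?_
  change rot _ y = rot 1 y
  rw [rot_mul, rot_reflMatrix, rot_reflMatrix, inner_sub_right, inner_smul_right,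
    real_inner_self_eq_norm_sq, hv]
  simp only [map_one, one_apply_eq_self]
  module

/-- The product of two reflections is a rotation. -/
lemma exists_SO_refl_refl {u v : Euc m} (hu : ‖u‖ = 1) (hv : ‖v‖ = 1) :
    ∃ A : SO m, ∀ y, rot A.1 y = rot (reflMatrix u) (rot (reflMatrix v) y) := by
  refine ⟨⟨reflMatrix u * reflMatrix v, Matrix.mem_specialOrthogonalGroup_iff.2 ⟨?_, ?_⟩⟩,
    fun y => rot_mul _ _ _⟩
  · refine (Matrix.mem_orthogonalGroup_iff' (Fin m) ℝ).2 ?_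
    change (reflMatrix u * reflMatrix v)ᵀ * (reflMatrix u * reflMatrix v) = 1
    rw [Matrix.transpose_mul, transpose_reflMatrix, transpose_reflMatrix, Matrix.mul_assoc,
      ← Matrix.mul_assoc (reflMatrix u), reflMatrix_mul_self hu, Matrix.one_mul,
      reflMatrix_mul_self hv]
  · rw [Matrix.det_mul, det_reflMatrix hu, det_reflMatrix hv]
    norm_num

/-- Two vectors of equal length are exchanged by a rotation, which inverts a given vector
orthogonal to both. -/
lemma exists_SO_map {a b w : Euc m} (hab : ‖a‖ = ‖b‖) (hw : ‖w‖ = 1) (ha : ⟪w, a⟫ = 0)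
    (hb : ⟪w, b⟫ = 0) (hne : a ≠ b) : ∃ A : SO m, rot A.1 a = b ∧ rot A.1 w = -w := by
  have hd : a - b ≠ 0 := sub_ne_zero.2 hne
  have hd' : ‖a - b‖ ≠ 0 := norm_ne_zero_iff.2 hd
  -- The reflection along `a - b` sends `a` to `b` and fixes `w`. The reflection along `w` then
  -- restores determinant one, fixes `b` and inverts `w`.
  set v : Euc m := ‖a - b‖⁻¹ • (a - b) with hvdef
  have hv : ‖v‖ = 1 := by
    rw [hvdef, norm_smul, norm_inv, norm_norm, inv_mul_cancel₀ hd']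
  obtain ⟨A, hA⟩ := exists_SO_refl_refl hw hv
  have h1 : rot (reflMatrix v) a = b := by
    have h2 : ‖a - b‖ ^ 2 = 2 * ⟪a - b, a⟫ := by
      rw [norm_sub_sq_real, inner_sub_left, real_inner_self_eq_norm_sq, real_inner_comm, ← hab]
      ring
    have h3 : 2 * ⟪v, a⟫ = ‖a - b‖ := by
      rw [hvdef, real_inner_smul_left]
      field_simp
      linarith
    rw [rot_reflMatrix, h3, hvdef, smul_smul, mul_inv_cancel₀ hd', one_smul, sub_sub_cancel]
  have hvw : ⟪v, w⟫ = 0 := by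
    rw [hvdef, real_inner_smul_left, inner_sub_left, real_inner_comm, ha, real_inner_comm, hb]
    simp
  refine ⟨A, ?_, ?_⟩
  · rw [hA, h1, rot_reflMatrix, hb]
    simp
  · rw [hA, rot_reflMatrix v w, hvw, mul_zero, zero_smul, sub_zero, rot_reflMatrix,
      real_inner_self_eq_norm_sq, hw]
    module

/-- Two vectors span at most a plane, a proper subspace since `m ≥ 3`. -/
lemma exists_unit_orthogonal (hm : 3 ≤ m) (a b : Euc m) :
    ∃ w : Euc m, ‖w‖ = 1 ∧ ⟪w, a⟫ = 0 ∧ ⟪w, b⟫ = 0 := by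
  set K : Submodule ℝ (Euc m) := Submodule.span ℝ {a, b} with hK
  have hr : Module.finrank ℝ K ≤ 2 := by
    refine (finrank_span_le_card ({a, b} : Set (Euc m))).trans ?_
    simpa using Finset.card_le_two (a := a) (b := b)
  have hne : Kᗮ ≠ ⊥ := by
    intro h
    rw [Submodule.orthogonal_eq_bot_iff] at h
    rw [h, finrank_top, finrank_euclideanSpace_fin] at hr
    omega
  obtain ⟨w, hw, hw0⟩ := Submodule.exists_mem_ne_zero_of_ne_bot hne
  have hn : ‖w‖ ≠ 0 := norm_ne_zero_iff.2 hw0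
  have ho : ∀ x ∈ K, ⟪w, x⟫ = 0 := fun x hx => by
    rw [real_inner_comm]
    exact hw x hx
  refine ⟨‖w‖⁻¹ • w, by rw [norm_smul, norm_inv, norm_norm, inv_mul_cancel₀ hn], ?_, ?_⟩
  · rw [real_inner_smul_left, ho a (Submodule.subset_span (by simp)), mul_zero]
  · rw [real_inner_smul_left, ho b (Submodule.subset_span (by simp)), mul_zero]

lemma exists_SO_eq (hm : 3 ≤ m) {a b : Euc m} (hab : ‖a‖ = ‖b‖) : ∃ A : SO m, rot A.1 a = b := by
  rcases eq_or_ne a b with rfl | hne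
  · exact ⟨1, by simp [rot]⟩
  · obtain ⟨w, hw, ha, hb⟩ := exists_unit_orthogonal hm a b
    obtain ⟨A, hA, -⟩ := exists_SO_map hab hw ha hb hne
    exact ⟨A, hA⟩

end Rotations

/-! ### Biinvariant metrics restricted to bivectors `y ∧ a` -/

section Biinvariant

open scoped RealInnerProductSpace

variable {m : ℕ}

lemma inner_rot_skew (U : LieSO m) (u v : Euc m) : ⟪rot U.1 u, v⟫ = -⟪u, rot U.1 v⟫ := by
  have hU : (U : Matrix (Fin m) (Fin m) ℝ)ᵀ = -U := (LieAlgebra.Orthogonal.mem_so _ _ _).1 U.2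
  rw [inner_rot, hU]
  simp [rot]

lemma inner_rot_self (U : LieSO m) (u : Euc m) : ⟪u, rot U.1 u⟫ = 0 := by
  have := inner_rot_skew U u u
  rw [real_inner_comm] at this
  linarith

/-- The linear form `U ↦ ⟪a, U y⟫` on `𝔰𝔬(m)`. -/
def momentForm (y a : Euc m) : Module.Dual ℝ (LieSO m) where
  toFun U := ⟪a, rot U.1 y⟫
  map_add' U V := by simp [rot, inner_add_right]
  map_smul' c U := by simp [rot, inner_smul_right]

lemma IsBiinvariant.nondegenerate {Q : LinearMap.BilinForm ℝ (LieSO m)} (hQ : IsBiinvariant Q) :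
    Q.Nondegenerate := by
  have h : ∀ U, Q U U = 0 → U = 0 := fun U hU => by
    by_contra h
    exact (hQ.pos U h).ne' hU
  exact ⟨fun U hU => h U (hU U), fun U hU => h U (hU U)⟩

/-- The element of `𝔰𝔬(m)` which represents `U ↦ ⟪a, U y⟫` with respect to `Q`. -/
def momentRep {Q : LinearMap.BilinForm ℝ (LieSO m)} (hQ : IsBiinvariant Q) (y a : Euc m) : LieSO m :=
  (Q.toDual hQ.nondegenerate).symm (momentForm y a)

variable {Q : LinearMap.BilinForm ℝ (LieSO m)} (hQ : IsBiinvariant Q)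

lemma momentRep_spec (y a : Euc m) (U : LieSO m) : Q (momentRep hQ y a) U = ⟪a, rot U.1 y⟫ :=
  LinearMap.BilinForm.apply_toDual_symm_apply _ _

lemma IsBiinvariant.ext {Q : LinearMap.BilinForm ℝ (LieSO m)} (hQ : IsBiinvariant Q) {V V' : LieSO m} (h : ∀ U, Q V U = Q V' U) : V = V' := by
  by_contra hne
  have := hQ.pos (V - V') (sub_ne_zero.2 hne)
  rw [LinearMap.map_sub₂, h, sub_self] at this
  exact this.false

lemma momentRep_add (y a b : Euc m) :
    momentRep hQ y (a + b) = momentRep hQ y a + momentRep hQ y b :=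
  hQ.ext fun U => by
    rw [map_add, LinearMap.add_apply]
    simp only [momentRep_spec, inner_add_left]

lemma momentRep_smul (y a : Euc m) (s : ℝ) :
    momentRep hQ y (s • a) = s • momentRep hQ y a :=
  hQ.ext fun U => by
    rw [map_smul, LinearMap.smul_apply]
    simp only [momentRep_spec, real_inner_smul_left, smul_eq_mul]

/-- Skewness of `U`: the representative behaves like the bivector of `y` and `a`. -/
lemma momentRep_swap (y a : Euc m) : momentRep hQ y a = -momentRep hQ a y :=
  hQ.ext fun U => by
    rw [map_neg, LinearMap.neg_apply, momentRep_spec, momentRep_spec, ← inner_rot_skew,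
      real_inner_comm]

lemma momentRep_smul_left (y a : Euc m) (s : ℝ) :
    momentRep hQ (s • y) a = s • momentRep hQ y a := by
  rw [momentRep_swap, momentRep_smul, momentRep_swap hQ y a, smul_neg]

lemma momentRep_self (y : Euc m) : momentRep hQ y y = 0 :=
  hQ.ext fun U => by
    rw [momentRep_spec, inner_rot_self]
    simp

lemma Ad_inv_Ad (A : SO m) (U : LieSO m) : Ad A (Ad A⁻¹ U) = U := by
  refine Subtype.ext ?_
  have h : (A⁻¹).1 = A.1ᵀ := rfl
  have h' : A.1 * A.1ᵀ = 1 := mul_eq_one_comm.1 (SO_transpose_mul A)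
  change A.1 * ((A⁻¹).1 * U.1 * (A⁻¹).1ᵀ) * A.1ᵀ = U.1
  rw [h, Matrix.transpose_transpose, Matrix.mul_assoc, Matrix.mul_assoc, Matrix.mul_assoc, h',
    Matrix.mul_one, ← Matrix.mul_assoc, h', Matrix.one_mul]

lemma rot_Ad (A : SO m) (U : LieSO m) (y : Euc m) :
    rot (Ad A U).1 (rot A.1 y) = rot A.1 (rot U.1 y) := by
  rw [← rot_mul, ← rot_mul]
  congr 2
  change A.1 * U.1 * A.1ᵀ * A.1 = _
  rw [Matrix.mul_assoc, SO_transpose_mul, Matrix.mul_one]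

lemma momentRep_rot (A : SO m) (y a : Euc m) :
    momentRep hQ (rot A.1 y) (rot A.1 a) = Ad A (momentRep hQ y a) :=
  hQ.ext fun U => by
    rw [momentRep_spec, ← Ad_inv_Ad A U, hQ.ad, momentRep_spec, rot_Ad, inner_rot_rot]

/-- The squared length of `momentRep`. -/
def momentSq (y a : Euc m) : ℝ := Q (momentRep hQ y a) (momentRep hQ y a)

lemma momentSq_nonneg (y a : Euc m) : 0 ≤ momentSq hQ y a := by
  rcases eq_or_ne (momentRep hQ y a) 0 with h | h
  · simp [momentSq, h]
  · exact (hQ.pos _ h).le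

lemma momentSq_rot (A : SO m) (y a : Euc m) :
    momentSq hQ (rot A.1 y) (rot A.1 a) = momentSq hQ y a := by
  rw [momentSq, momentRep_rot, hQ.ad, momentSq]

lemma momentSq_swap (y a : Euc m) : momentSq hQ y a = momentSq hQ a y := by
  rw [momentSq, momentRep_swap, momentSq]
  simp

lemma momentSq_smul (y a : Euc m) (r s : ℝ) :
    momentSq hQ (r • y) (s • a) = r ^ 2 * s ^ 2 * momentSq hQ y a := by
  rw [momentSq, momentRep_smul, momentRep_smul_left, momentSq]
  simp
  ring

/-- Some rotation takes `a` to `b` while inverting `y`; the sign disappears in the square. -/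
lemma momentSq_eq_of_orthogonal {y a b : Euc m} (hy : ‖y‖ = 1) (hab : ‖a‖ = ‖b‖) (ha : ⟪y, a⟫ = 0)
    (hb : ⟪y, b⟫ = 0) : momentSq hQ y a = momentSq hQ y b := by
  rcases eq_or_ne a b with rfl | hne
  · rfl
  · obtain ⟨A, hA, hA'⟩ := exists_SO_map hab hy ha hb hne
    rw [← momentSq_rot hQ A, hA, hA']
    have := momentSq_smul hQ y b (-1) 1
    simpa using this

/-- For every biinvariant metric on `SO(m)`, the squared length of `y ∧ a` is a constant multiple
of the squared area of the parallelogram spanned by `y` and `a`. -/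
lemma exists_momentSq_eq (hm : 3 ≤ m) : ∃ κ : ℝ, 0 ≤ κ ∧ ∀ y a : Euc m,
    momentSq hQ y a = κ * (‖y‖ ^ 2 * ‖a‖ ^ 2 - ⟪y, a⟫ ^ 2) := by
  obtain ⟨y₀, hy₀, -, -⟩ := exists_unit_orthogonal hm (0 : Euc m) 0
  obtain ⟨a₀, ha₀, h₀, -⟩ := exists_unit_orthogonal hm y₀ y₀
  have hunit : ∀ y a : Euc m, ‖y‖ = 1 → ‖a‖ = 1 → ⟪y, a⟫ = 0 →
      momentSq hQ y a = momentSq hQ y₀ a₀ := by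
    intro y a hy ha hya
    -- With `b` orthogonal to both `y` and `y₀`, one vector can be changed at a time: `(y, a)`, `(y,
    -- b)`, `(y₀, b)`, `(y₀, a₀)`.
    obtain ⟨b, hb, hby, hby₀⟩ := exists_unit_orthogonal hm y y₀
    rw [momentSq_eq_of_orthogonal hQ hy (ha.trans hb.symm) hya (by rwa [real_inner_comm]),
      momentSq_swap, momentSq_eq_of_orthogonal hQ hb (hy.trans hy₀.symm) hby hby₀, momentSq_swap,
      momentSq_eq_of_orthogonal hQ hy₀ (hb.trans ha₀.symm) (by rwa [real_inner_comm])
        (by rwa [real_inner_comm])]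
  have hscale : ∀ v : Euc m, ∃ u : Euc m, v = ‖v‖ • u ∧ (v = 0 ∨ ‖u‖ = 1) := by
    intro v
    rcases eq_or_ne v 0 with rfl | hv
    · exact ⟨0, by simp⟩
    · refine ⟨‖v‖⁻¹ • v, ?_, Or.inr ?_⟩
      · rw [smul_smul, mul_inv_cancel₀ (norm_ne_zero_iff.2 hv), one_smul]
      · rw [norm_smul, norm_inv, norm_norm, inv_mul_cancel₀ (norm_ne_zero_iff.2 hv)]
  have hort : ∀ y a : Euc m, ⟪y, a⟫ = 0 →
      momentSq hQ y a = momentSq hQ y₀ a₀ * (‖y‖ ^ 2 * ‖a‖ ^ 2) := by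
    intro y a hya
    have hz : ∀ v : Euc m, momentSq hQ v 0 = 0 := fun v => by simpa using momentSq_smul hQ v 0 1 0
    rcases eq_or_ne y 0 with rfl | hy0
    · rw [momentSq_swap, hz]; simp
    rcases eq_or_ne a 0 with rfl | ha0
    · rw [hz]; simp
    obtain ⟨y', hy', hy1⟩ := hscale y
    obtain ⟨a', ha', ha1⟩ := hscale a
    have hya' : ⟪y', a'⟫ = 0 := by
      rw [hy', ha', real_inner_smul_left, inner_smul_right] at hya
      simpa [hy0, ha0] using hya
    conv_lhs => rw [hy', ha', momentSq_smul,
      hunit y' a' (hy1.resolve_left hy0) (ha1.resolve_left ha0) hya']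
    ring
  refine ⟨momentSq hQ y₀ a₀, momentSq_nonneg hQ _ _, fun y a => ?_⟩
  rcases eq_or_ne y 0 with rfl | hy0
  · rw [hort 0 a (inner_zero_left a)]; simp
  have hn : ‖y‖ ^ 2 ≠ 0 := pow_ne_zero 2 (norm_ne_zero_iff.2 hy0)
  -- Gram–Schmidt: the component of `a` along `y` has zero representative and does not affect the
  -- area.
  set s : ℝ := ⟪y, a⟫ / ‖y‖ ^ 2 with hs
  have hya : ⟪y, a - s • y⟫ = 0 := by
    rw [inner_sub_right, inner_smul_right, real_inner_self_eq_norm_sq, hs]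
    field_simp
    ring
  have h1 : momentSq hQ y a = momentSq hQ y (a - s • y) := by
    have : momentRep hQ y (a - s • y) = momentRep hQ y a := by
      rw [sub_eq_add_neg, ← neg_smul, momentRep_add, momentRep_smul, momentRep_self]
      simp
    rw [momentSq, momentSq, this]
  have h2 : ‖a - s • y‖ ^ 2 = ‖a‖ ^ 2 - ⟪y, a⟫ ^ 2 / ‖y‖ ^ 2 := by
    rw [norm_sub_sq_real, inner_smul_right, norm_smul, mul_pow, Real.norm_eq_abs, sq_abs,
      real_inner_comm y a, hs]
    field_simp
    ring
  rw [h1, hort _ _ hya, h2]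
  field_simp

/-- The vector field of `momentRep hQ y a` at `y`. -/
lemma exists_rot_momentRep (hm : 3 ≤ m) : ∃ κ : ℝ, 0 ≤ κ ∧ ∀ y a : Euc m,
    rot (momentRep hQ y a).1 y = κ • (‖y‖ ^ 2 • a - ⟪y, a⟫ • y) := by
  obtain ⟨κ, hκ, h⟩ := exists_momentSq_eq hQ hm
  refine ⟨κ, hκ, fun y a => ext_inner_left ℝ fun b => ?_⟩
  -- The pairing with `b` is now `Q (momentRep hQ y b) (momentRep hQ y a)`, found by polarizing the
  -- quadratic formula for `momentSq`.
  rw [← momentRep_spec hQ y b]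
  have h1 := h y (b + a)
  have h2 := h y b
  have h3 := h y a
  simp only [momentSq] at h1 h2 h3
  rw [momentRep_add, LinearMap.map_add₂, map_add, map_add, h2, h3,
    hQ.symm (momentRep hQ y a), norm_add_sq_real, inner_add_right] at h1
  rw [inner_smul_right, inner_sub_right, inner_smul_right, inner_smul_right, real_inner_comm y b]
  linear_combination h1 / 2

end Biinvariant

/-! ### Identification of the Cheeger deformations -/

section Cheeger

open scoped RealInnerProductSpace

variable {m : ℕ}

lemma ambForm_zero (q u v : Amb m) : ambForm 0 q u v = confFactor (xPart q) * ⟪u, v⟫ := by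
  simp [ambForm_apply, cheegerCoeff]

lemma inner_pairAmb_zero (u : Amb m) (y : Euc m) : ⟪u, pairAmb 0 y⟫ = ⟪yPart u, y⟫ := by
  simp [inner_amb]

lemma blockAct_pairAmb_zero (A : Matrix (Fin m) (Fin m) ℝ) (y : Euc m) :
    blockAct A (pairAmb 0 y) = pairAmb 0 (rot A y) :=
  amb_ext (by simp [xPart_blockAct]) (by simp [yPart_blockAct])

lemma blockAct_injective (A : SO m) : Function.Injective (blockAct (m := m) A.1) := by
  intro u v h
  have h1 : blockCLM A.1 (u - v) = 0 := by
    rw [map_sub, blockCLM_apply, blockCLM_apply, h, sub_self]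
  rw [blockCLM_apply, ← norm_eq_zero, blockAct_norm, norm_eq_zero] at h1
  exact sub_eq_zero.1 h1

/-- Writing the `𝔰𝔬(m)` component as `Ad a U` moves the action field from `a q` back to `q`, so that
`a` only acts as an outer isometry. -/
lemma sphIncl_cheegerProjDeriv (q : Sph m) (a : SO m) (z : TangentSpace (𝓡 (m + 2)) q)
    (U : LieSO m) : sphIncl (a • q) (cheegerProjDeriv q a (z, Ad a U))
      = blockAct a.1 (sphIncl q z + pairAmb 0 (rot U.1 (yPart (q : Amb m)))) := by
  rw [cheegerProjDeriv, map_add, sphIncl_dAct, sphIncl_actionField, coe_smul_sph, yPart_blockAct,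
    rot_Ad, ← blockCLM_apply, ← blockCLM_apply, map_add, blockCLM_apply, blockCLM_apply,
    blockAct_pairAmb_zero]

lemma exists_Ad_eq (a : SO m) (V : LieSO m) : ∃ U, Ad a U = V := ⟨Ad a⁻¹ V, Ad_inv_Ad a V⟩

variable {Q : LinearMap.BilinForm ℝ (LieSO m)} (hQ : IsBiinvariant Q)

/-- The element of `𝔰𝔬(m)` that makes a tangent vector of the sphere horizontal in `S × SO(m)`. -/
def cheegerRep (t : ℝ) (q : Sph m) (z : TangentSpace (𝓡 (m + 2)) q) : LieSO m :=
  (t * confFactor (xPart (q : Amb m))) • momentRep hQ (yPart (q : Amb m)) (yPart (sphIncl q z))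

lemma cheegerRep_spec (t : ℝ) (q : Sph m) (z : TangentSpace (𝓡 (m + 2)) q) (U : LieSO m) :
    Q (cheegerRep hQ t q z) U
      = t * confFactor (xPart (q : Amb m)) * ⟪yPart (sphIncl q z), rot U.1 (yPart (q : Amb m))⟫ := by
  rw [cheegerRep, map_smul, LinearMap.smul_apply, momentRep_spec, smul_eq_mul]

lemma cheegerProduct_zero_metric (t : ℝ) (q : Sph m)
    (z k : TangentSpace (𝓡 (m + 2)) q × LieSO m) :
    cheegerProduct (cheegerMetric m le_rfl) Q t q z k
      = confFactor (xPart (q : Amb m)) * ⟪sphIncl q z.1, sphIncl q k.1⟫ + 1 / t * Q z.2 k.2 := by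
  rw [cheegerProduct, cheegerMetric_inner, ambForm_zero]

/-- The kernel consists of the pairs `(-U*, Ad a U)`. Orthogonality to all of them prescribes `Q
z.2`, hence `z.2`, in terms of `z.1`. -/
lemma cheeger_horizontal_iff {t : ℝ} (ht : 0 < t) (q : Sph m) (a : SO m)
    (z : TangentSpace (𝓡 (m + 2)) q × LieSO m) :
    (∀ k, cheegerProjDeriv q a k = 0 →
        cheegerProduct (cheegerMetric m le_rfl) Q t q z k = 0) ↔
      z.2 = Ad a (cheegerRep hQ t q z.1) := by
  have hker : ∀ (k : TangentSpace (𝓡 (m + 2)) q) (U : LieSO m),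
      cheegerProjDeriv q a (k, Ad a U) = 0 ↔
        sphIncl q k = -pairAmb 0 (rot U.1 (yPart (q : Amb m))) := by
    intro k U
    rw [← (sphIncl_injective (a • q)).eq_iff, sphIncl_cheegerProjDeriv, map_zero]
    have h0 : blockAct a.1 (0 : Amb m) = 0 := by rw [← blockCLM_apply, map_zero]
    rw [(blockAct_injective a).eq_iff' h0, eq_neg_iff_add_eq_zero]
  have hval : ∀ (k : TangentSpace (𝓡 (m + 2)) q) (U : LieSO m),
      sphIncl q k = -pairAmb 0 (rot U.1 (yPart (q : Amb m))) →
      cheegerProduct (cheegerMetric m le_rfl) Q t q z (k, Ad a U)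
        = 1 / t * (Q z.2 (Ad a U) - Q (Ad a (cheegerRep hQ t q z.1)) (Ad a U)) := by
    intro k U hk
    rw [cheegerProduct_zero_metric, hk, inner_neg_right, inner_pairAmb_zero, hQ.ad, cheegerRep_spec]
    field_simp
    ring
  constructor
  · intro h
    refine hQ.ext fun V => ?_
    obtain ⟨U, rfl⟩ := exists_Ad_eq a V
    have hk : sphIncl q (-actionField U q) = -pairAmb 0 (rot U.1 (yPart (q : Amb m))) := by
      rw [map_neg, sphIncl_actionField]
    have h1 := h (-actionField U q, Ad a U) ((hker _ _).2 hk)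
    rw [hval _ _ hk] at h1
    have h2 : 1 / t ≠ 0 := by positivity
    exact sub_eq_zero.1 ((mul_eq_zero.1 h1).resolve_left h2)
  · rintro h ⟨k, V⟩ hk
    obtain ⟨U, rfl⟩ := exists_Ad_eq a V
    rw [hval _ _ ((hker _ _).1 hk), h, sub_self, mul_zero]

section

variable {κ : ℝ} (hκ : ∀ y a : Euc m, rot (momentRep hQ y a).1 y = κ • (‖y‖ ^ 2 • a - ⟪y, a⟫ • y))

/-- The rescaling of the vertical part of a vector under the Cheeger projection. -/
def cheegerShift (τ : ℝ) (y : Euc m) (u : Amb m) : Amb m :=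
  u + pairAmb 0 (τ • (‖y‖ ^ 2 • yPart u - ⟪y, yPart u⟫ • y))

include hκ in
lemma sphIncl_cheegerProjDeriv_rep (t : ℝ) (q : Sph m) (a : SO m)
    (z : TangentSpace (𝓡 (m + 2)) q) :
    sphIncl (a • q) (cheegerProjDeriv q a (z, Ad a (cheegerRep hQ t q z)))
      = blockAct a.1 (cheegerShift (t * κ * confFactor (xPart (q : Amb m))) (yPart (q : Amb m))
        (sphIncl q z)) := by
  have h : rot (cheegerRep hQ t q z).1 (yPart (q : Amb m))
      = (t * confFactor (xPart (q : Amb m))) •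
        rot (momentRep hQ (yPart (q : Amb m)) (yPart (sphIncl q z))).1 (yPart (q : Amb m)) := by
    simp [cheegerRep, rot]
  rw [sphIncl_cheegerProjDeriv, cheegerShift, h, hκ, smul_smul]
  congr 4
  ring

/-- On vectors tangent to the orbit, with `e` the conformal factor and `τ = c e`, the shift is
multiplication by `1 + τ r²` and `ambForm c` is `e / (1 + τ r²)` times the inner product. The result
`e (1 + τ r²)` matches the squared length of the horizontal lift. -/
lemma ambForm_cheegerShift {c : ℝ} (hc : 0 ≤ c) (q u v : Amb m) :
    ambForm c q (cheegerShift (c * confFactor (xPart q)) (yPart q) u)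
      (cheegerShift (c * confFactor (xPart q)) (yPart q) v)
      = confFactor (xPart q) * (⟪u, v⟫
        + c * confFactor (xPart q) * orbitForm (yPart q) (yPart u) (yPart v)) := by
  have hd := (cheegerCoeff_denom_pos hc q).ne'
  rw [ambForm_apply, orbitForm_apply, orbitForm_apply, cheegerCoeff]
  simp only [cheegerShift, inner_amb, map_add, xPart_pairAmb, yPart_pairAmb,
    inner_add_left, inner_add_right, real_inner_smul_left, inner_smul_right, inner_sub_left,
    inner_sub_right, inner_zero_left, inner_zero_right, real_inner_self_eq_norm_sq,
    real_inner_comm (yPart q) (yPart u)]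
  generalize confFactor (xPart q) = e at *
  generalize ‖yPart q‖ = r at *
  have hd' : c * e / (1 + c * e * r ^ 2) * (1 + c * e * r ^ 2) = c * e := div_mul_cancel₀ _ hd
  generalize c * e / (1 + c * e * r ^ 2) = k at *
  linear_combination (-e * (1 + c * e * r ^ 2) * (r ^ 2 * ⟪yPart u, yPart v⟫
    - ⟪yPart q, yPart u⟫ * ⟪yPart q, yPart v⟫)) * hd'

lemma exists_cheegerShift_eq {τ : ℝ} (hτ : 0 ≤ τ) (q w : Amb m) (hw : ⟪q, w⟫ = 0) :
    ∃ u, ⟪q, u⟫ = 0 ∧ cheegerShift τ (yPart q) u = w := by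
  have hd : 1 + τ * ‖yPart q‖ ^ 2 ≠ 0 := by positivity
  set y := yPart q
  -- The shift fixes `y` and scales its orthogonal complement in `ℝᵐ` by `1 + τ |y|²`; this is the
  -- inverse map.
  refine ⟨pairAmb (xPart w) ((1 + τ * ‖y‖ ^ 2)⁻¹ • (yPart w + (τ * ⟪y, yPart w⟫) • y)), ?_, ?_⟩
  · rw [inner_amb] at hw ⊢
    rw [← hw, xPart_pairAmb, yPart_pairAmb, inner_smul_right, inner_add_right, inner_smul_right,
      real_inner_self_eq_norm_sq]
    field_simp
    ring
  · refine amb_ext (by simp [cheegerShift]) ?_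
    simp only [cheegerShift, map_add, yPart_pairAmb, inner_smul_right, inner_add_right,
      real_inner_self_eq_norm_sq]
    match_scalars
    · field_simp
    · field_simp
      ring

include hκ in
lemma cheegerProduct_rep {t : ℝ} (ht : 0 < t) (hκ0 : 0 ≤ κ) (q : Sph m) (a : SO m)
    (z z' : TangentSpace (𝓡 (m + 2)) q) :
    cheegerProduct (cheegerMetric m le_rfl) Q t q (z, Ad a (cheegerRep hQ t q z))
        (z', Ad a (cheegerRep hQ t q z'))
      = ambForm (t * κ) ((a • q : Sph m) : Amb m)
          (sphIncl (a • q) (cheegerProjDeriv q a (z, Ad a (cheegerRep hQ t q z))))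
          (sphIncl (a • q) (cheegerProjDeriv q a (z', Ad a (cheegerRep hQ t q z')))) := by
  have hc : 0 ≤ t * κ := by positivity
  have h : rot (cheegerRep hQ t q z').1 (yPart (q : Amb m))
      = (t * confFactor (xPart (q : Amb m))) •
        rot (momentRep hQ (yPart (q : Amb m)) (yPart (sphIncl q z'))).1 (yPart (q : Amb m)) := by
    simp [cheegerRep, rot]
  rw [cheegerProduct_zero_metric, sphIncl_cheegerProjDeriv_rep hQ hκ,
    sphIncl_cheegerProjDeriv_rep hQ hκ, coe_smul_sph, ambForm_blockAct, ambForm_cheegerShift hc,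
    hQ.ad, cheegerRep_spec, h, hκ, orbitForm_apply]
  simp only [inner_smul_right, inner_sub_right, real_inner_comm (yPart (q : Amb m))]
  field_simp

include hκ in
lemma exists_horizontal_lift {t : ℝ} (ht : 0 < t) (hκ0 : 0 ≤ κ) (q : Sph m) (a : SO m)
    (w : TangentSpace (𝓡 (m + 2)) (a • q)) :
    ∃ z, cheegerProjDeriv q a (z, Ad a (cheegerRep hQ t q z)) = w := by
  have hτ : 0 ≤ t * κ * confFactor (xPart (q : Amb m)) := by
    have := confFactor_pos (xPart (q : Amb m))
    positivity
  have hinv : blockAct a.1 (blockAct (a⁻¹).1 (sphIncl (a • q) w)) = sphIncl (a • q) w := by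
    have h' : a.1 * (a⁻¹).1 = 1 := mul_eq_one_comm.1 (SO_transpose_mul a)
    refine amb_ext (by rw [xPart_blockAct, xPart_blockAct]) ?_
    rw [yPart_blockAct, yPart_blockAct, ← rot_mul, h']
    simp [rot]
  have hort : ⟪(q : Amb m), blockAct (a⁻¹).1 (sphIncl (a • q) w)⟫ = 0 := by
    rw [← inner_blockAct a, hinv, ← coe_smul_sph, inner_sphIncl]
  obtain ⟨u, hu, hu'⟩ := exists_cheegerShift_eq hτ q.1 _ hort
  obtain ⟨z, rfl⟩ := exists_sphIncl_eq q hu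
  refine ⟨z, sphIncl_injective _ ?_⟩
  rw [sphIncl_cheegerProjDeriv_rep hQ hκ, hu', hinv]

include hκ in
/-- The metric induced by `ambForm (t κ)` is the Cheeger deformation with parameter `t`. -/
lemma isCheegerDeformation_cheegerMetric {t : ℝ} (ht : 0 < t) (hκ0 : 0 ≤ κ) (hc : 0 ≤ t * κ) :
    IsCheegerDeformation (cheegerMetric m le_rfl) Q t (cheegerMetric m hc) := by
  intro q a
  refine ⟨fun w => ?_, ?_⟩
  · obtain ⟨z, hz⟩ := exists_horizontal_lift hQ hκ ht hκ0 q a w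
    exact ⟨_, hz⟩
  · rintro ⟨z, V⟩ ⟨z', V'⟩ h h'
    obtain rfl : V = Ad a (cheegerRep hQ t q z) := (cheeger_horizontal_iff hQ ht q a _).1 h
    obtain rfl : V' = Ad a (cheegerRep hQ t q z') := (cheeger_horizontal_iff hQ ht q a _).1 h'
    exact (cheegerProduct_rep hQ hκ ht hκ0 q a z z').symm

include hκ in
-- Uniqueness of the deformation: every tangent vector has a horizontal lift, so the submersion
-- property forces the inner product. The fibre over `a = 1` suffices.
lemma IsCheegerDeformation.inner_eq {t : ℝ} (ht : 0 < t) (hκ0 : 0 ≤ κ) {gt : SphMetric m}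
    (h : IsCheegerDeformation (cheegerMetric m le_rfl) Q t gt) (p : Sph m)
    (u v : TangentSpace (𝓡 (m + 2)) p) :
    gt.inner p u v = ambForm (t * κ) p.1 (sphIncl p u) (sphIncl p v) := by
  have key : ∀ p' : Sph m, (1 : SO m) • p = p' → ∀ u v : TangentSpace (𝓡 (m + 2)) p',
      gt.inner p' u v = ambForm (t * κ) p'.1 (sphIncl p' u) (sphIncl p' v) := by
    rintro _ rfl u v
    obtain ⟨z, rfl⟩ := exists_horizontal_lift hQ hκ ht hκ0 p 1 u
    obtain ⟨z', rfl⟩ := exists_horizontal_lift hQ hκ ht hκ0 p 1 v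
    rw [← cheegerProduct_rep hQ hκ ht hκ0]
    exact (h p 1).2 _ _ ((cheeger_horizontal_iff hQ ht p 1 _).2 rfl)
      ((cheeger_horizontal_iff hQ ht p 1 _).2 rfl)
  exact key p (one_smul _ p) u v

end

end Cheeger

/-! ### Second derivatives -/

section SecondDerivatives

open Topology

variable {V W : Type} [NormedAddCommGroup V] [NormedSpace ℝ V] [NormedAddCommGroup W]
  [NormedSpace ℝ W]

lemma fderiv_fderiv_clm_comp (L : W →L[ℝ] ℝ) {f : V → W} (hf : ContDiff ℝ ∞ f) (y e v : V) :
    fderiv ℝ (fderiv ℝ fun z => L (f z)) y e v = L (fderiv ℝ (fderiv ℝ f) y e v) := by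
  have h1 : fderiv ℝ (fun z => L (f z)) = fun z => L.comp (fderiv ℝ f z) := by
    funext z
    exact (L.hasFDerivAt.comp z (hf.differentiable (by simp) z).hasFDerivAt).fderiv
  have h2 : HasFDerivAt (fderiv ℝ f) (fderiv ℝ (fderiv ℝ f) y) y :=
    ((hf.fderiv_right (m := ∞) (by simp)).differentiable (by simp) y).hasFDerivAt
  have h3 : HasFDerivAt (fun z => L.comp (fderiv ℝ f z))
      ((ContinuousLinearMap.compL ℝ V W ℝ L).comp (fderiv ℝ (fderiv ℝ f) y)) y :=
    (ContinuousLinearMap.compL ℝ V W ℝ L).hasFDerivAt.comp y h2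
  rw [h1, h3.fderiv]
  rfl

/-- Pure second derivatives only see the restriction to a line. This is applied to a line on which
the Cheeger correction vanishes identically. -/
lemma fderiv_fderiv_apply_self {f : V → ℝ} (hf : ContDiff ℝ ∞ f) (v : V) :
    fderiv ℝ (fderiv ℝ f) 0 v v = deriv (deriv fun s : ℝ => f (s • v)) 0 := by
  have hs : ∀ s : ℝ, HasDerivAt (fun s : ℝ => s • v) v s := fun s => by
    simpa using (hasDerivAt_id s).smul_const v
  have h1 : deriv (fun s : ℝ => f (s • v)) = fun s => fderiv ℝ f (s • v) v := by
    funext s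
    exact ((hf.differentiable (by simp) (s • v)).hasFDerivAt.comp_hasDerivAt s (hs s)).deriv
  have h2 : HasFDerivAt (fderiv ℝ f) (fderiv ℝ (fderiv ℝ f) 0) ((0 : ℝ) • v) := by
    rw [zero_smul]
    exact ((hf.fderiv_right (m := ∞) (by simp)).differentiable (by simp) 0).hasFDerivAt
  have h3 : HasDerivAt (fun s : ℝ => fderiv ℝ f (s • v)) (fderiv ℝ (fderiv ℝ f) 0 v) 0 :=
    h2.comp_hasDerivAt (0 : ℝ) (hs 0)
  have h4 : HasDerivAt (fun s : ℝ => fderiv ℝ f (s • v) v) (fderiv ℝ (fderiv ℝ f) 0 v v) 0 :=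
    ((ContinuousLinearMap.apply ℝ ℝ v).hasFDerivAt.comp_hasDerivAt (0 : ℝ) h3)
  rw [h1, h4.deriv]

lemma hasFDerivAt_div {f g : V → ℝ} {f' g' : V →L[ℝ] ℝ} {x : V} (hf : HasFDerivAt f f' x)
    (hg : HasFDerivAt g g' x) (h0 : g x ≠ 0) :
    HasFDerivAt (fun z => f z / g z) ((g x)⁻¹ • f' - (f x / g x ^ 2) • g') x := by
  have h := hf.mul ((hasDerivAt_inv h0).comp_hasFDerivAt x hg)
  simp only [div_eq_mul_inv]
  refine h.congr_fderiv ?_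
  ext e
  simp
  ring

lemma hasFDerivAt_norm_sq {E : Type} [NormedAddCommGroup E] [InnerProductSpace ℝ E] (z : E) :
    HasFDerivAt (fun y : E => ‖y‖ ^ 2) ((2 : ℝ) • dotForm E z) z :=
  (hasStrictFDerivAt_norm_sq z).hasFDerivAt.congr_fderiv
    (ContinuousLinearMap.ext fun e => by simp)

end SecondDerivatives

/-! ### Ricci curvature at the pole in stereographic coordinates -/

section StereographicRicci

open scoped RealInnerProductSpace
open Topology

variable {m d : ℕ}

/-- The conformal factor of the metric in stereographic coordinates. -/
def stereoFactor (β y : Euc d) : ℝ :=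
  4 * (4 + ‖y‖ ^ 2) ^ 2 / (80 + 16 * ‖y‖ ^ 2 + 5 * (‖y‖ ^ 2) ^ 2 + 24 * ⟪β, y⟫ ^ 2) ^ 2

lemma contDiff_stereoFactor (β : Euc d) : ContDiff ℝ ∞ (stereoFactor β) := by
  unfold stereoFactor
  have h1 : ContDiff ℝ ∞ fun y : Euc d => ‖y‖ ^ 2 := contDiff_norm_sq ℝ
  have h2 : ContDiff ℝ ∞ fun y : Euc d => ⟪β, y⟫ := (dotForm (Euc d) β).contDiff
  refine ContDiff.div (by fun_prop) (by fun_prop) fun y => ?_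
  positivity

lemma hasFDerivAt_stereoFactor (β z : Euc d) : HasFDerivAt (stereoFactor β)
    ((2 * (8 * (4 + ‖z‖ ^ 2) / (80 + 16 * ‖z‖ ^ 2 + 5 * (‖z‖ ^ 2) ^ 2 + 24 * ⟪β, z⟫ ^ 2) ^ 2
      - 8 * (4 + ‖z‖ ^ 2) ^ 2 * (16 + 10 * ‖z‖ ^ 2) /
        (80 + 16 * ‖z‖ ^ 2 + 5 * (‖z‖ ^ 2) ^ 2 + 24 * ⟪β, z⟫ ^ 2) ^ 3)) • dotForm (Euc d) z
      + (-384 * (4 + ‖z‖ ^ 2) ^ 2 /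
        (80 + 16 * ‖z‖ ^ 2 + 5 * (‖z‖ ^ 2) ^ 2 + 24 * ⟪β, z⟫ ^ 2) ^ 3 * ⟪β, z⟫) • dotForm (Euc d) β)
    z := by
  have h1 : HasFDerivAt (fun y : Euc d => ‖y‖ ^ 2) ((2 : ℝ) • dotForm (Euc d) z) z :=
    hasFDerivAt_norm_sq z
  have h2 : HasFDerivAt (fun y : Euc d => ⟪β, y⟫) (dotForm (Euc d) β) z :=
    (dotForm (Euc d) β).hasFDerivAt
  have hD : 80 + 16 * ‖z‖ ^ 2 + 5 * (‖z‖ ^ 2) ^ 2 + 24 * ⟪β, z⟫ ^ 2 ≠ 0 := by positivity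
  have h3 := hasFDerivAt_div (((h1.const_add 4).pow 2).const_mul 4)
    (((((h1.const_mul 16).const_add 80).add ((h1.pow 2).const_mul 5)).add
      ((h2.pow 2).const_mul 24)).pow 2) (pow_ne_zero 2 hD)
  refine h3.congr_fderiv ?_
  ext e
  simp
  generalize ‖z‖ = r at *
  generalize ⟪β, z⟫ = t at *
  generalize ⟪β, e⟫ = u at *
  generalize ⟪z, e⟫ = w at *
  field_simp
  ring

lemma fderiv_fderiv_stereoFactor (β e v : Euc d) :
    fderiv ℝ (fderiv ℝ (stereoFactor β)) 0 e v
      = 1 / 500 * ⟪e, v⟫ - 3 / 250 * (⟪β, e⟫ * ⟪β, v⟫) := by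
  have h0 : fderiv ℝ (stereoFactor β) = _ := funext fun z => (hasFDerivAt_stereoFactor β z).fderiv
  have h1 : ContDiff ℝ ∞ fun y : Euc d => ‖y‖ ^ 2 := contDiff_norm_sq ℝ
  have h2 : ContDiff ℝ ∞ fun y : Euc d => ⟪β, y⟫ := (dotForm (Euc d) β).contDiff
  have hD : ∀ z : Euc d, 80 + 16 * ‖z‖ ^ 2 + 5 * (‖z‖ ^ 2) ^ 2 + 24 * ⟪β, z⟫ ^ 2 ≠ 0 :=
    fun z => by positivity
  -- The coefficients in the gradient multiply terms linear in `z`, so at `0` only their values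
  -- matter; mere differentiability is enough.
  have hd1 : DifferentiableAt ℝ (fun z : Euc d => 2 * (8 * (4 + ‖z‖ ^ 2) /
      (80 + 16 * ‖z‖ ^ 2 + 5 * (‖z‖ ^ 2) ^ 2 + 24 * ⟪β, z⟫ ^ 2) ^ 2
      - 8 * (4 + ‖z‖ ^ 2) ^ 2 * (16 + 10 * ‖z‖ ^ 2) /
        (80 + 16 * ‖z‖ ^ 2 + 5 * (‖z‖ ^ 2) ^ 2 + 24 * ⟪β, z⟫ ^ 2) ^ 3)) 0 := by
    refine ContDiffAt.differentiableAt (n := ∞) (ContDiff.contDiffAt ?_) (by simp)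
    exact contDiff_const.mul ((ContDiff.div (by fun_prop) (by fun_prop)
      fun z => pow_ne_zero 2 (hD z)).sub (ContDiff.div (by fun_prop) (by fun_prop)
      fun z => pow_ne_zero 3 (hD z)))
  have hd2 : DifferentiableAt ℝ (fun z : Euc d => -384 * (4 + ‖z‖ ^ 2) ^ 2 /
        (80 + 16 * ‖z‖ ^ 2 + 5 * (‖z‖ ^ 2) ^ 2 + 24 * ⟪β, z⟫ ^ 2) ^ 3) 0 := by
    refine ContDiffAt.differentiableAt (n := ∞) (ContDiff.contDiffAt ?_) (by simp)
    exact ContDiff.div (by fun_prop) (by fun_prop) fun z => pow_ne_zero 3 (hD z)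
  have h3 := (hd1.hasFDerivAt.smul ((dotForm (Euc d)).hasFDerivAt (x := 0))).add
    ((hd2.hasFDerivAt.mul ((dotForm (Euc d) β).hasFDerivAt (x := 0))).smul_const (dotForm (Euc d) β))
  rw [h0]
  refine (congrArg (fun T : Euc d →L[ℝ] Euc d →L[ℝ] ℝ => T e v) h3.fderiv).trans ?_
  simp
  norm_num
  ring

/-- `orbitForm y` ignores multiples of `y`, so the radial terms in the derivative of the
stereographic parametrization drop out. -/
lemma orbitForm_smul_sub_smul (y u v : Euc m) (a k l : ℝ) :
    orbitForm (a • y) (a • u - k • y) (a • v - l • y) = a ^ 4 * orbitForm y u v := by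
  simp only [orbitForm_apply, norm_smul, inner_sub_left, inner_sub_right, real_inner_smul_left,
    inner_smul_right, mul_pow, Real.norm_eq_abs, sq_abs, real_inner_self_eq_norm_sq,
    real_inner_comm y u]
  ring

/-- The inverse of the stereographic projection from the first coordinate axis. -/
def stereoParam (ι : Euc d →ₗᵢ[ℝ] Amb m) (y : Euc d) : Amb m :=
  (4 / (4 + ‖y‖ ^ 2)) • ι y + (2 * (4 / (4 + ‖y‖ ^ 2)) - 1) • pairAmb (EuclideanSpace.single 0 1) 0

lemma contDiff_stereoParam (ι : Euc d →ₗᵢ[ℝ] Amb m) : ContDiff ℝ ∞ (stereoParam ι) := by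
  unfold stereoParam
  have h1 : ContDiff ℝ ∞ fun y : Euc d => 4 / (4 + ‖y‖ ^ 2) :=
    contDiff_const.div (contDiff_const.add (contDiff_norm_sq ℝ)) fun y => by positivity
  have h2 : ContDiff ℝ ∞ fun y : Euc d => ι y := ι.toContinuousLinearMap.contDiff
  fun_prop

lemma fderiv_stereoParam (ι : Euc d →ₗᵢ[ℝ] Amb m) (y u : Euc d) :
    fderiv ℝ (stereoParam ι) y u = (4 / (4 + ‖y‖ ^ 2)) • ι u
      - ((4 / (4 + ‖y‖ ^ 2)) ^ 2 / 2 * ⟪y, u⟫) •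
        (ι y + (2 : ℝ) • pairAmb (EuclideanSpace.single 0 1) 0) := by
  have h1 : HasFDerivAt (fun y : Euc d => ‖y‖ ^ 2) ((2 : ℝ) • dotForm (Euc d) y) y :=
    hasFDerivAt_norm_sq y
  have hD : 4 + ‖y‖ ^ 2 ≠ 0 := by positivity
  have h2 : HasFDerivAt (fun y : Euc d => 4 / (4 + ‖y‖ ^ 2))
      ((-(4 / (4 + ‖y‖ ^ 2)) ^ 2 / 2) • dotForm (Euc d) y) y := by
    refine (hasFDerivAt_div (hasFDerivAt_const (4 : ℝ) y) (h1.const_add 4) hD).congr_fderiv ?_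
    ext e
    simp
    field_simp
    ring
  have h3 := (h2.smul (ι.toContinuousLinearMap.hasFDerivAt (x := y))).add
    (((h2.const_mul 2).sub_const 1).smul_const (pairAmb (EuclideanSpace.single 0 1) 0 : Amb m))
  have h4 : HasFDerivAt (stereoParam ι) _ y := h3
  rw [h4.fderiv]
  simp
  module

/-- The metric `ambForm c` in stereographic coordinates. -/
def stereoForm (c : ℝ) (ι : Euc d →ₗᵢ[ℝ] Amb m) (y : Euc d) : Euc d →L[ℝ] Euc d →L[ℝ] ℝ :=
  (ambForm c (stereoParam ι y)).bilinearComp (fderiv ℝ (stereoParam ι) y)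
    (fderiv ℝ (stereoParam ι) y)

lemma contDiff_stereoForm {c : ℝ} (hc : 0 ≤ c) (ι : Euc d →ₗᵢ[ℝ] Amb m) :
    ContDiff ℝ ∞ (stereoForm c ι) := by
  have h1 : ContDiff ℝ ∞ fun y => ambForm c (stereoParam ι y) :=
    (contDiff_ambForm hc).comp (contDiff_stereoParam ι)
  have h2 : ContDiff ℝ ∞ (fderiv ℝ (stereoParam ι)) :=
    (contDiff_stereoParam ι).fderiv_right (by simp)
  have h3 := (contDiff_bilinearComp (V := Euc d) (E := Amb m)).comp (h2.prodMk h1)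
  exact h3

/-- The coefficient of the vertical correction in stereographic coordinates. -/
def stereoCoeff (c : ℝ) (ι : Euc d →ₗᵢ[ℝ] Amb m) (y : Euc d) : ℝ :=
  confFactor (xPart (stereoParam ι y)) * cheegerCoeff c (confFactor (xPart (stereoParam ι y)))
    (‖yPart (stereoParam ι y)‖ ^ 2) * (4 / (4 + ‖y‖ ^ 2)) ^ 4

lemma contDiff_stereoCoeff {c : ℝ} (hc : 0 ≤ c) (ι : Euc d →ₗᵢ[ℝ] Amb m) :
    ContDiff ℝ ∞ (stereoCoeff c ι) := by
  have h0 := contDiff_stereoParam ι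
  have h1 : ContDiff ℝ ∞ fun y => confFactor (xPart (stereoParam ι y)) :=
    contDiff_confFactor.comp (xPart.contDiff.comp h0)
  have h2 := (contDiff_cheegerCoeff hc).comp h0
  have h3 : ContDiff ℝ ∞ fun y : Euc d => 4 / (4 + ‖y‖ ^ 2) :=
    contDiff_const.div (contDiff_const.add (contDiff_norm_sq ℝ)) fun y => by positivity
  exact (h1.mul h2).mul (h3.pow 4)

section

variable {ι : Euc d →ₗᵢ[ℝ] Amb m}

lemma inner_fderiv_stereoParam (hι : ∀ y, xPart (ι y) 0 = 0) (y u v : Euc d) :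
    ⟪fderiv ℝ (stereoParam ι) y u, fderiv ℝ (stereoParam ι) y v⟫
      = (4 / (4 + ‖y‖ ^ 2)) ^ 2 * ⟪u, v⟫ := by
  have h0 : ∀ u, ⟪ι u, pairAmb (EuclideanSpace.single 0 1) 0⟫ = 0 := fun u => by
    simp [inner_amb, hι, EuclideanSpace.inner_single_right]
  have h0' : ∀ u, ⟪(pairAmb (EuclideanSpace.single 0 1) 0 : Amb m), ι u⟫ = 0 := fun u => by
    rw [real_inner_comm, h0]
  have h1 : ⟪(pairAmb (EuclideanSpace.single 0 1) 0 : Amb m), pairAmb (EuclideanSpace.single 0 1) 0⟫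
      = 1 := by
    rw [inner_amb]
    simp
  rw [fderiv_stereoParam, fderiv_stereoParam]
  simp only [inner_sub_left, inner_sub_right, inner_add_left, inner_add_right,
    real_inner_smul_left, inner_smul_right, h0, h0', h1, ι.inner_map_map,
    real_inner_self_eq_norm_sq, real_inner_comm y u]
  have hD : 4 + ‖y‖ ^ 2 ≠ 0 := by positivity
  field_simp
  ring

lemma confFactor_stereoParam (hι : ∀ y, xPart (ι y) 0 = 0) {β : Euc d}
    (hβ : ι β = pairAmb (EuclideanSpace.single 1 1) 0) (y : Euc d) :
    confFactor (xPart (stereoParam ι y)) * (4 / (4 + ‖y‖ ^ 2)) ^ 2 = stereoFactor β y := by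
  have h1 : ⟪β, y⟫ = xPart (ι y) 1 := by
    rw [← ι.inner_map_map, hβ]
    simp [inner_amb, EuclideanSpace.inner_single_left]
  have hD : 4 + ‖y‖ ^ 2 ≠ 0 := by positivity
  have hx0 : xPart (stereoParam ι y) 0 = 2 * (4 / (4 + ‖y‖ ^ 2)) - 1 := by
    simp [stereoParam, hι]
  have hx1 : xPart (stereoParam ι y) 1 = 4 / (4 + ‖y‖ ^ 2) * xPart (ι y) 1 := by
    simp [stereoParam]
  rw [confFactor, hx0, hx1, stereoFactor, h1]
  have h2 : 80 + 16 * ‖y‖ ^ 2 + 5 * (‖y‖ ^ 2) ^ 2 + 24 * xPart (ι y) 1 ^ 2 ≠ 0 := by positivity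
  have h3 : 7 + 3 * ((2 * (4 / (4 + ‖y‖ ^ 2)) - 1) ^ 2 + (4 / (4 + ‖y‖ ^ 2) * xPart (ι y) 1) ^ 2)
      = 2 * (80 + 16 * ‖y‖ ^ 2 + 5 * (‖y‖ ^ 2) ^ 2 + 24 * xPart (ι y) 1 ^ 2)
        / (4 + ‖y‖ ^ 2) ^ 2 := by
    field_simp
    ring
  rw [h3]
  field_simp
  ring

lemma stereoForm_apply (hι : ∀ y, xPart (ι y) 0 = 0) {β : Euc d}
    (hβ : ι β = pairAmb (EuclideanSpace.single 1 1) 0) (c : ℝ) (y u v : Euc d) :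
    stereoForm c ι y u v = stereoFactor β y * ⟪u, v⟫
      - stereoCoeff c ι y * orbitForm (yPart (ι y)) (yPart (ι u)) (yPart (ι v)) := by
  have hy : yPart (stereoParam ι y) = (4 / (4 + ‖y‖ ^ 2)) • yPart (ι y) := by
    simp [stereoParam]
  have hy' : ∀ u, yPart (fderiv ℝ (stereoParam ι) y u) = (4 / (4 + ‖y‖ ^ 2)) • yPart (ι u)
      - ((4 / (4 + ‖y‖ ^ 2)) ^ 2 / 2 * ⟪y, u⟫) • yPart (ι y) := fun u => by
    rw [fderiv_stereoParam]
    simp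
  rw [stereoForm, ContinuousLinearMap.bilinearComp_apply, ambForm_apply,
    inner_fderiv_stereoParam hι, hy', hy', ← confFactor_stereoParam hι hβ, stereoCoeff]
  nth_rw 2 [hy]
  rw [orbitForm_smul_sub_smul]
  ring

lemma stereoForm_symm (c : ℝ) (y u v : Euc d) : stereoForm c ι y u v = stereoForm c ι y v u :=
  ambForm_symm _ _ _ _

lemma stereoForm_zero (hι : ∀ y, xPart (ι y) 0 = 0) {β : Euc d}
    (hβ : ι β = pairAmb (EuclideanSpace.single 1 1) 0) (c : ℝ) :
    stereoForm c ι 0 = (1 / 100 : ℝ) • dotForm (Euc d) := by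
  ext u v : 2
  rw [stereoForm_apply hι hβ, stereoFactor, orbitForm_apply]
  simp
  norm_num

lemma hasFDerivAt_orbitForm_zero (η : Euc d →L[ℝ] Euc m) (u v : Euc m) :
    HasFDerivAt (fun y => orbitForm (η y) u v) (0 : Euc d →L[ℝ] ℝ) 0 := by
  have h1 : HasFDerivAt (fun y => ‖η y‖ ^ 2) ((((2 : ℝ) • dotForm (Euc m) (η 0))).comp η) 0 :=
    (hasFDerivAt_norm_sq (η 0)).comp 0 η.hasFDerivAt
  have h2 : ∀ u : Euc m, HasFDerivAt (fun y => ⟪η y, u⟫) (((dotForm (Euc m)).flip u).comp η) 0 :=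
    fun u => ((dotForm (Euc m)).flip u).hasFDerivAt.comp 0 η.hasFDerivAt
  have h3 := (h1.mul_const ⟪u, v⟫).sub ((h2 u).mul (h2 v))
  simp only [orbitForm_apply]
  refine h3.congr_fderiv ?_
  ext e
  simp

/-- The conformal factor is even in `y`, and the correction vanishes to second order at the fixed
point. -/
lemma fderiv_stereoForm_zero {c : ℝ} (hc : 0 ≤ c) (hι : ∀ y, xPart (ι y) 0 = 0) {β : Euc d}
    (hβ : ι β = pairAmb (EuclideanSpace.single 1 1) 0) : fderiv ℝ (stereoForm c ι) 0 = 0 := by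
  ext e u v
  have h1 : HasFDerivAt (stereoForm c ι) (fderiv ℝ (stereoForm c ι) 0) 0 :=
    ((contDiff_stereoForm hc ι).differentiable (by simp) 0).hasFDerivAt
  have h2 : HasFDerivAt (fun y => stereoForm c ι y u v)
      (((fderiv ℝ (stereoForm c ι) 0).flip u).flip v) 0 :=
    (ContinuousLinearMap.apply ℝ ℝ v).hasFDerivAt.comp (0 : Euc d)
      ((ContinuousLinearMap.apply ℝ (Euc d →L[ℝ] ℝ) u).hasFDerivAt.comp (0 : Euc d) h1)
  have h3 : HasFDerivAt (stereoCoeff c ι) (fderiv ℝ (stereoCoeff c ι) 0) 0 :=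
    ((contDiff_stereoCoeff hc ι).differentiable (by simp) 0).hasFDerivAt
  have h4 := ((hasFDerivAt_stereoFactor β 0).mul_const ⟪u, v⟫).sub
    (h3.mul (hasFDerivAt_orbitForm_zero (yPart.comp ι.toContinuousLinearMap)
      (yPart (ι u)) (yPart (ι v))))
  have h5 : HasFDerivAt (fun y => stereoForm c ι y u v) _ 0 :=
    h4.congr_of_eventuallyEq (Filter.Eventually.of_forall fun y => stereoForm_apply hι hβ c y u v)
  refine (DFunLike.congr_fun (h2.unique h5) e).trans ?_
  simp [orbitForm_apply]

lemma fderiv_fderiv_stereoForm_apply {c : ℝ} (hc : 0 ≤ c) (e f u v : Euc d) :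
    fderiv ℝ (fderiv ℝ (stereoForm c ι)) 0 e f u v
      = fderiv ℝ (fderiv ℝ fun y => stereoForm c ι y u v) 0 e f := by
  let L : (Euc d →L[ℝ] Euc d →L[ℝ] ℝ) →L[ℝ] ℝ :=
    (ContinuousLinearMap.apply ℝ ℝ v).comp (ContinuousLinearMap.apply ℝ (Euc d →L[ℝ] ℝ) u)
  exact (fderiv_fderiv_clm_comp L (contDiff_stereoForm hc ι) 0 e f).symm

/-- The deformation parameter drops out: each second derivative in the Ricci formula either has `v`
in a slot of the metric or is taken twice along `v`, and in both cases the correction does not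
contribute. What remains is the Ricci curvature of the conformally round metric. -/
lemma ricciCoord_stereoForm {c : ℝ} (hc : 0 ≤ c) (hι : ∀ y, xPart (ι y) 0 = 0) {β v : Euc d}
    (hβ : ι β = pairAmb (EuclideanSpace.single 1 1) 0)
    (hv : ι v = pairAmb (EuclideanSpace.single 2 1) 0) :
    ricciCoord (stereoForm c ι) 0 v v = (8 - 2 * d) / 10 := by
  have hG := contDiff_stereoForm hc ι
  have hA := contDiff_stereoFactor β
  have hyv : yPart (ι v) = 0 := by rw [hv, yPart_pairAmb]
  have hvv : ⟪v, v⟫ = 1 := by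
    rw [← ι.inner_map_map, hv, inner_amb]
    simp
  have hββ : ⟪β, β⟫ = 1 := by
    rw [← ι.inner_map_map, hβ, inner_amb]
    simp
  have hβv : ⟪β, v⟫ = 0 := by
    rw [← ι.inner_map_map, hβ, hv]
    simp [inner_amb, EuclideanSpace.inner_single_left]
  -- `v` has no `ℝᵐ` component, so it annihilates the correction.
  have h1 : ∀ e f u : Euc d, fderiv ℝ (fderiv ℝ (stereoForm c ι)) 0 e f v u
      = ⟪v, u⟫ * fderiv ℝ (fderiv ℝ (stereoFactor β)) 0 e f := by
    intro e f u
    have h : (fun y => stereoForm c ι y v u)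
        = fun y => (ContinuousLinearMap.lsmul ℝ ℝ ⟪v, u⟫) (stereoFactor β y) := by
      funext y
      rw [stereoForm_apply hι hβ, hyv, orbitForm_apply]
      simp [mul_comm]
    rw [fderiv_fderiv_stereoForm_apply hc, h, fderiv_fderiv_clm_comp _ hA]
    rfl
  -- The line `s • v` stays in the fixed point set, where the correction is zero.
  have h2 : ∀ u : Euc d, fderiv ℝ (fderiv ℝ (stereoForm c ι)) 0 v v u u
      = ⟪u, u⟫ * fderiv ℝ (fderiv ℝ (stereoFactor β)) 0 v v := by
    intro u
    have h : (fun s : ℝ => stereoForm c ι (s • v) u u)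
        = fun s => (ContinuousLinearMap.lsmul ℝ ℝ ⟪u, u⟫) (stereoFactor β (s • v)) := by
      funext s
      rw [stereoForm_apply hι hβ, map_smul, map_smul, hyv, orbitForm_apply]
      simp [mul_comm]
    have hGu : ContDiff ℝ ∞ fun y => stereoForm c ι y u u :=
      ((ContinuousLinearMap.apply ℝ ℝ u).comp
        (ContinuousLinearMap.apply ℝ (Euc d →L[ℝ] ℝ) u)).contDiff.comp hG
    have hAu : ContDiff ℝ ∞ fun y => (ContinuousLinearMap.lsmul ℝ ℝ ⟪u, u⟫) (stereoFactor β y) :=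
      (ContinuousLinearMap.lsmul ℝ ℝ ⟪u, u⟫).contDiff.comp hA
    rw [fderiv_fderiv_stereoForm_apply hc, fderiv_fderiv_apply_self hGu, h,
      ← fderiv_fderiv_apply_self hAu]
    exact fderiv_fderiv_clm_comp _ hA 0 v v
  have h3 : HasFDerivAt (fderiv ℝ (stereoForm c ι)) (fderiv ℝ (fderiv ℝ (stereoForm c ι)) 0) 0 :=
    ((hG.fderiv_right (m := ∞) (by simp)).differentiable (by simp) 0).hasFDerivAt
  rw [ricciCoord_of_fderiv_eq_zero (by norm_num) (hG.differentiable (by simp) 0)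
    (stereoForm_zero hι hβ c) (fderiv_stereoForm_zero hc hι hβ) h3 (fun e f u v => by
      rw [fderiv_fderiv_stereoForm_apply hc, fderiv_fderiv_stereoForm_apply hc]
      simp only [stereoForm_symm c _ u v])]
  simp only [h1, h2, fderiv_fderiv_stereoFactor, hvv, hβv, inner_single_one,
    real_inner_comm v (EuclideanSpace.single _ _)]
  have h4 : ∀ i : Fin d, (EuclideanSpace.single i 1 : Euc d) i = 1 :=
    fun i => by simp
  simp only [h4]
  have h5 : ∑ i, v i * v i = 1 := by rw [← inner_eq_sum, hvv]
  have h6 : ∑ i, β i * β i = 1 := by rw [← inner_eq_sum, hββ]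
  -- These terms sum to `(4 - d) / 250`; the prefactor is `(2 / 100)⁻¹ = 50`.
  have h7 : ∀ i : Fin d, 2 * (v i * (1 / 500 * v i - 3 / 250 * (β i * 0)))
      - 1 * (1 / 500 * 1 - 3 / 250 * (β i * β i)) - 1 * (1 / 500 * 1 - 3 / 250 * (0 * 0))
      = 1 / 250 * (v i * v i) + 3 / 250 * (β i * β i) - 1 / 250 := fun i => by ring
  simp only [h7, Finset.sum_add_distrib, Finset.sum_sub_distrib, ← Finset.mul_sum, h5, h6,
    Finset.sum_const, Finset.card_univ, Fintype.card_fin, nsmul_eq_mul]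
  ring

end

end StereographicRicci

/-! ### Negative Ricci curvature at the fixed point -/

section FixedPoint

open scoped RealInnerProductSpace
open Topology

/-- The point `(1, 0, 0; 0)` of the sphere, which is fixed by the action. -/
def basePt (m : ℕ) : Sph m :=
  ⟨pairAmb (EuclideanSpace.single 0 1) 0, by
    rw [mem_sphere_zero_iff_norm, ← sq_eq_sq₀ (norm_nonneg _) zero_le_one, norm_sq_amb]
    simp⟩

/-- The coordinates of the orthogonal complement of the base point that are used by the chart. -/
def baseCoord (m : ℕ) : (ℝ ∙ ((-basePt m : Sph m) : Amb m))ᗮ ≃ₗᵢ[ℝ] Euc (m + 2) :=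
  (OrthonormalBasis.fromOrthogonalSpanSingleton (m + 2)
    (ne_zero_of_mem_unit_sphere (-basePt m))).repr

/-- The isometric embedding of the coordinate space as the tangent space at the base point. -/
def baseIncl (m : ℕ) : Euc (m + 2) →ₗᵢ[ℝ] Amb m :=
  (Submodule.subtypeₗᵢ _).comp (baseCoord m).symm.toLinearIsometry

lemma baseIncl_apply (m : ℕ) (y : Euc (m + 2)) :
    baseIncl m y = ((baseCoord m).symm y : Amb m) := rfl

lemma xPart_baseIncl_zero (m : ℕ) (y : Euc (m + 2)) : xPart (baseIncl m y) 0 = 0 := by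
  have h : ⟪((-basePt m : Sph m) : Amb m), baseIncl m y⟫ = 0 :=
    Submodule.mem_orthogonal_singleton_iff_inner_right.1 ((baseCoord m).symm y).2
  simpa [basePt, inner_amb, EuclideanSpace.inner_single_left] using h

lemma exists_baseIncl_eq (m : ℕ) {x : Euc 3} (hx : x 0 = 0) : ∃ v, baseIncl m v = pairAmb x 0 := by
  have h : (pairAmb x 0 : Amb m) ∈ (ℝ ∙ ((-basePt m : Sph m) : Amb m))ᗮ := by
    rw [Submodule.mem_orthogonal_singleton_iff_inner_right]
    simp [basePt, inner_amb, EuclideanSpace.inner_single_left, hx]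
  exact ⟨baseCoord m ⟨_, h⟩, by rw [baseIncl_apply, LinearIsometryEquiv.symm_apply_apply]⟩

/-- The preferred chart at a point of the sphere is stereographic projection from its antipode;
`baseIncl` absorbs the choice of orthonormal basis. -/
lemma coe_extChartAt_basePt_symm (m : ℕ) (y : Euc (m + 2)) :
    (((extChartAt (𝓡 (m + 2)) (basePt m)).symm y : Sph m) : Amb m) = stereoParam (baseIncl m) y := by
  have h := stereographic'_symm_apply (-basePt m) y
  have h' : (((extChartAt (𝓡 (m + 2)) (basePt m)).symm y : Sph m) : Amb m)
      = (‖baseIncl m y‖ ^ 2 + 4)⁻¹ • (4 : ℝ) • baseIncl m y + (‖baseIncl m y‖ ^ 2 + 4)⁻¹ •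
        (‖baseIncl m y‖ ^ 2 - 4) • -pairAmb (EuclideanSpace.single 0 1) 0 := h
  have hD : ‖y‖ ^ 2 + 4 ≠ 0 := by positivity
  rw [h', (baseIncl m).norm_map, stereoParam, add_comm 4 (‖y‖ ^ 2)]
  match_scalars
  · field_simp
  · field_simp
    ring

lemma extChartAt_basePt_self (m : ℕ) : extChartAt (𝓡 (m + 2)) (basePt m) (basePt m) = 0 := by
  set y := extChartAt (𝓡 (m + 2)) (basePt m) (basePt m) with hy
  have h1 : stereoParam (baseIncl m) y = (basePt m : Amb m) := by
    rw [← coe_extChartAt_basePt_symm, hy, extChartAt_to_inv]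
  have h2 := congrArg (fun q : Amb m => xPart q 0) h1
  have hD : 4 + ‖y‖ ^ 2 ≠ 0 := by positivity
  simp [stereoParam, xPart_baseIncl_zero, basePt] at h2
  field_simp at h2
  have h3 : ‖y‖ ^ 2 = 0 := by linarith
  simpa using h3

/-- One vector `X`, in the `x₂` direction, serves all `c` at once. With `d = m + 2 ≥ 5` the value
`(8 - 2d)/10` is at most `-1/5`. -/
lemma exists_ricci_neg {m : ℕ} (hm : 3 ≤ m) : ∃ X : TangentSpace (𝓡 (m + 2)) (basePt m),
    ∀ (c : ℝ), 0 ≤ c → ∀ g : SphMetric m,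
      (∀ p u v, g.inner p u v = ambForm c (p : Amb m) (sphIncl p u) (sphIncl p v)) →
        ricci g (basePt m) X X < 0 := by
  obtain ⟨β, hβ⟩ := exists_baseIncl_eq m (x := EuclideanSpace.single 1 1) (by simp)
  obtain ⟨v, hv⟩ := exists_baseIncl_eq m (x := EuclideanSpace.single 2 1) (by simp)
  refine ⟨v, fun c hc g hg => ?_⟩
  have h := ricci_eq_ricciCoord (F := ((↑) : Sph m → Amb m)) contMDiff_coe_sphere hg (basePt m)
    (Φ := stereoParam (baseIncl m))
    (Filter.Eventually.of_forall fun y => coe_extChartAt_basePt_symm m y) v v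
  rw [h, extChartAt_basePt_self]
  refine (ricciCoord_stereoForm hc (xPart_baseIncl_zero m) hβ hv).trans_lt ?_
  have hm' : (3 : ℝ) ≤ m := by exact_mod_cast hm
  push_cast
  linarith

/-- The orbit is a single point, so all action fields vanish there. -/
lemma isHorizontal_basePt {m : ℕ} (g : SphMetric m) (X : TangentSpace (𝓡 (m + 2)) (basePt m)) :
    IsHorizontal g (basePt m) X := by
  intro U
  have h : actionField U (basePt m) = 0 := by
    refine sphIncl_injective _ ?_
    rw [sphIncl_actionField, map_zero]
    exact amb_ext (by simp) (by simp [basePt])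
  rw [h, map_zero]

end FixedPoint

/-! ### The quotient metric on the unit ball and its Ricci curvature -/

section BallMetric

open scoped RealInnerProductSpace
open Topology

/-- The orthogonal projection of `ℝ³` onto the plane of the first two coordinates. -/
def planeProj : Euc 3 →L[ℝ] Euc 3 :=
  (EuclideanSpace.proj (𝕜 := ℝ) (0 : Fin 3)).smulRight (EuclideanSpace.single 0 1)
    + (EuclideanSpace.proj (𝕜 := ℝ) (1 : Fin 3)).smulRight (EuclideanSpace.single 1 1)

lemma planeProj_apply (u : Euc 3) :
    planeProj u = u 0 • EuclideanSpace.single 0 1 + u 1 • EuclideanSpace.single 1 1 := rfl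

lemma inner_planeProj (u v : Euc 3) : ⟪planeProj u, v⟫ = u 0 * v 0 + u 1 * v 1 := by
  simp [planeProj_apply, inner_add_left, real_inner_smul_left, EuclideanSpace.inner_single_left]

lemma inner_planeProj_right (u v : Euc 3) : ⟪u, planeProj v⟫ = ⟪planeProj u, v⟫ := by
  rw [real_inner_comm, inner_planeProj, inner_planeProj]
  ring

lemma inner_planeProj_planeProj (u v : Euc 3) :
    ⟪planeProj u, planeProj v⟫ = ⟪planeProj u, v⟫ := by
  rw [inner_planeProj, inner_planeProj]
  simp [planeProj_apply]

lemma inner_planeProj_self_nonneg (u : Euc 3) : 0 ≤ ⟪planeProj u, u⟫ := by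
  rw [← inner_planeProj_planeProj]
  exact real_inner_self_nonneg

lemma inner_planeProj_self_le (u : Euc 3) : ⟪planeProj u, u⟫ ≤ ‖u‖ ^ 2 := by
  rw [inner_planeProj, ← real_inner_self_eq_norm_sq, inner_eq_sum, Fin.sum_univ_three]
  nlinarith [mul_self_nonneg (u 2)]

/-- The metric `ballFactor⁻² ⟨·, ·⟩` on the unit ball of `ℝ³` is the metric of the quotient. -/
def ballFactor (b : Euc 3) : ℝ := (7 * (1 + ‖b‖ ^ 2) + 12 * ⟪planeProj b, b⟫ / (1 + ‖b‖ ^ 2)) / 2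

lemma ballFactor_pos (b : Euc 3) : 0 < ballFactor b := by
  have := inner_planeProj_self_nonneg b
  unfold ballFactor
  positivity

/-- The gradient of `ballFactor`. -/
def ballGrad (b : Euc 3) : Euc 3 :=
  (7 - 12 * ⟪planeProj b, b⟫ / (1 + ‖b‖ ^ 2) ^ 2) • b + (12 / (1 + ‖b‖ ^ 2)) • planeProj b

/-- The Hessian of `ballFactor`. -/
def ballHess (b : Euc 3) : Euc 3 →L[ℝ] Euc 3 :=
  (7 - 12 * ⟪planeProj b, b⟫ / (1 + ‖b‖ ^ 2) ^ 2) • ContinuousLinearMap.id ℝ (Euc 3)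
    + (12 / (1 + ‖b‖ ^ 2)) • planeProj
    - ((24 / (1 + ‖b‖ ^ 2) ^ 2) • dotForm (Euc 3) b).smulRight (planeProj b)
    - ((24 / (1 + ‖b‖ ^ 2) ^ 2) • dotForm (Euc 3) (planeProj b)).smulRight b
    + ((48 * ⟪planeProj b, b⟫ / (1 + ‖b‖ ^ 2) ^ 3) • dotForm (Euc 3) b).smulRight b

lemma ballHess_apply (b v : Euc 3) : ballHess b v =
    (7 - 12 * ⟪planeProj b, b⟫ / (1 + ‖b‖ ^ 2) ^ 2) • v + (12 / (1 + ‖b‖ ^ 2)) • planeProj v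
    - (24 / (1 + ‖b‖ ^ 2) ^ 2 * ⟪b, v⟫) • planeProj b
    - (24 / (1 + ‖b‖ ^ 2) ^ 2 * ⟪planeProj b, v⟫) • b
    + (48 * ⟪planeProj b, b⟫ / (1 + ‖b‖ ^ 2) ^ 3 * ⟪b, v⟫) • b := by
  simp [ballHess]

lemma hasFDerivAt_inner_planeProj (b : Euc 3) :
    HasFDerivAt (fun z => ⟪planeProj z, z⟫) ((2 : ℝ) • dotForm (Euc 3) (planeProj b)) b := by
  refine (planeProj.hasFDerivAt.inner ℝ (hasFDerivAt_id b)).congr_fderiv ?_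
  ext e
  simp
  rw [← inner_planeProj_right, real_inner_comm]
  ring

lemma hasFDerivAt_ballFactor (b : Euc 3) :
    HasFDerivAt ballFactor (dotForm (Euc 3) (ballGrad b)) b := by
  have hN := (hasFDerivAt_norm_sq b).const_add 1
  have hD : 1 + ‖b‖ ^ 2 ≠ 0 := by positivity
  have h := ((hN.const_mul 7).add
    (hasFDerivAt_div ((hasFDerivAt_inner_planeProj b).const_mul 12) hN hD)).mul_const (2⁻¹ : ℝ)
  have h' : HasFDerivAt ballFactor _ b := h
  refine h'.congr_fderiv ?_
  ext e
  simp [ballGrad]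
  field_simp
  ring

lemma hasFDerivAt_ballGrad (b : Euc 3) : HasFDerivAt ballGrad (ballHess b) b := by
  have hN := (hasFDerivAt_norm_sq b).const_add 1
  have hD : 1 + ‖b‖ ^ 2 ≠ 0 := by positivity
  have h := (((hasFDerivAt_div ((hasFDerivAt_inner_planeProj b).const_mul 12) (hN.pow 2)
    (pow_ne_zero 2 hD)).const_sub 7).smul (hasFDerivAt_id b)).add
    ((hasFDerivAt_div (hasFDerivAt_const (12 : ℝ) b) hN hD).smul planeProj.hasFDerivAt)
  have h' : HasFDerivAt ballGrad _ b := h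
  refine h'.congr_fderiv (ContinuousLinearMap.ext fun e => ?_)
  rw [ballHess_apply]
  simp
  match_scalars <;> field_simp <;> ring

lemma inner_ballHess (b u v : Euc 3) : ⟪ballHess b u, v⟫ = ⟪u, ballHess b v⟫ := by
  rw [ballHess_apply, ballHess_apply]
  simp only [inner_add_left, inner_add_right, inner_sub_left, inner_sub_right, inner_smul_right,
    real_inner_smul_left, inner_planeProj_right, real_inner_comm (planeProj b) u,
    real_inner_comm b u]
  ring

/-- Completing the square isolates a nonnegative term that the Ricci bound can discard. -/
lemma inner_ballHess_self (b v : Euc 3) : ⟪ballHess b v, v⟫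
    = (7 - 12 * ⟪planeProj b, b⟫ / (1 + ‖b‖ ^ 2) ^ 2) * ⟪v, v⟫ + 12 / (1 + ‖b‖ ^ 2) *
      ‖planeProj (v - (2 * ⟪b, v⟫ / (1 + ‖b‖ ^ 2)) • b)‖ ^ 2 := by
  have hD : 1 + ‖b‖ ^ 2 ≠ 0 := by positivity
  rw [ballHess_apply, ← real_inner_self_eq_norm_sq (planeProj _), inner_planeProj_planeProj]
  simp only [map_sub, map_smul, inner_add_left, inner_sub_left, inner_sub_right, inner_smul_right,
    real_inner_smul_left, ← inner_planeProj_right v b, real_inner_comm (planeProj b) v]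
  field_simp
  ring

lemma sum_ballHess (b : Euc 3) : ∑ i, ballHess b (EuclideanSpace.single i 1) i
    = 21 + 24 / (1 + ‖b‖ ^ 2) - 36 * ⟪planeProj b, b⟫ / (1 + ‖b‖ ^ 2) ^ 2
      - 48 * ⟪planeProj b, b⟫ / (1 + ‖b‖ ^ 2) ^ 3 := by
  have hD : 1 + ‖b‖ ^ 2 ≠ 0 := by positivity
  have hb : ‖b‖ ^ 2 = b 0 * b 0 + b 1 * b 1 + b 2 * b 2 := by
    rw [← real_inner_self_eq_norm_sq, inner_eq_sum, Fin.sum_univ_three]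
  have hP : ⟪planeProj b, b⟫ = b 0 * b 0 + b 1 * b 1 := inner_planeProj b b
  simp only [ballHess_apply, inner_single_one, Fin.sum_univ_three, PiLp.add_apply, PiLp.sub_apply,
    PiLp.smul_apply, smul_eq_mul, hP]
  simp [planeProj_apply]
  have h2 : b 2 * b 2 = ‖b‖ ^ 2 - b 0 * b 0 - b 1 * b 1 := by rw [hb]; ring
  field_simp
  linear_combination (48 * (b 0 * b 0 + b 1 * b 1)) * h2

lemma norm_sq_ballGrad (b : Euc 3) : ⟪ballGrad b, ballGrad b⟫
    = (7 - 12 * ⟪planeProj b, b⟫ / (1 + ‖b‖ ^ 2) ^ 2) ^ 2 * ‖b‖ ^ 2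
      + 2 * (7 - 12 * ⟪planeProj b, b⟫ / (1 + ‖b‖ ^ 2) ^ 2) * (12 / (1 + ‖b‖ ^ 2))
        * ⟪planeProj b, b⟫ + (12 / (1 + ‖b‖ ^ 2)) ^ 2 * ⟪planeProj b, b⟫ := by
  rw [ballGrad]
  simp only [inner_add_left, inner_add_right, inner_smul_right, real_inner_smul_left,
    inner_planeProj_right, real_inner_self_eq_norm_sq]
  rw [← real_inner_self_eq_norm_sq (planeProj b), inner_planeProj_planeProj]
  ring

/-- Without the square from the Hessian, the right side is `(182 - 162 q) ⟪v, v⟫`, where `q` is `x₀²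
+ x₁²` in the coordinates of the half-sphere. As `q ≤ 1`, the factor is at least `20`. -/
lemma ball_ricci_bound (b v : Euc 3) : ⟪v, v⟫ ≤ ballFactor b * ⟪ballHess b v, v⟫
    + (ballFactor b * (∑ i, ballHess b (EuclideanSpace.single i 1) i)
      - 2 * ⟪ballGrad b, ballGrad b⟫) * ⟪v, v⟫ := by
  have hU := ballFactor_pos b
  have hD : 0 < 1 + ‖b‖ ^ 2 := by positivity
  -- From `⟪planeProj b, b⟫ ≤ |b|²` and `4 |b|² ≤ (1 + |b|²)²`.
  have hq : 4 * ⟪planeProj b, b⟫ / (1 + ‖b‖ ^ 2) ^ 2 ≤ 1 := by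
    rw [div_le_one (by positivity)]
    nlinarith [inner_planeProj_self_le b, sq_nonneg (‖b‖ ^ 2 - 1)]
  have key : ballFactor b * (7 - 12 * ⟪planeProj b, b⟫ / (1 + ‖b‖ ^ 2) ^ 2)
      + (ballFactor b * (∑ i, ballHess b (EuclideanSpace.single i 1) i)
      - 2 * ⟪ballGrad b, ballGrad b⟫)
      = 182 - 162 * (4 * ⟪planeProj b, b⟫ / (1 + ‖b‖ ^ 2) ^ 2) := by
    rw [sum_ballHess, norm_sq_ballGrad, ballFactor]
    field_simp
    ring
  rw [inner_ballHess_self]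
  have h1 : 0 ≤ ballFactor b * (12 / (1 + ‖b‖ ^ 2) *
      ‖planeProj (v - (2 * ⟪b, v⟫ / (1 + ‖b‖ ^ 2)) • b)‖ ^ 2) := by positivity
  have h2 : 0 ≤ ⟪v, v⟫ := real_inner_self_nonneg
  nlinarith [mul_le_mul_of_nonneg_right hq h2]

lemma contDiff_ballFactor : ContDiff ℝ ∞ ballFactor := by
  have h1 : ContDiff ℝ ∞ fun b : Euc 3 => ‖b‖ ^ 2 := contDiff_norm_sq ℝ
  have h2 : ContDiff ℝ ∞ fun b : Euc 3 => ⟪planeProj b, b⟫ := planeProj.contDiff.inner ℝ contDiff_id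
  have h3 : ContDiff ℝ ∞ fun b : Euc 3 => 12 * ⟪planeProj b, b⟫ / (1 + ‖b‖ ^ 2) :=
    (contDiff_const.mul h2).div (contDiff_const.add h1) fun b => by positivity
  unfold ballFactor
  fun_prop

/-- The unit ball of `ℝ³`. -/
abbrev unitBall : TopologicalSpace.Opens (Euc 3) := ⟨Metric.ball 0 1, Metric.isOpen_ball⟩

lemma coe_extChartAt_unitBall_symm (b : unitBall) :
    ((↑) : unitBall → Euc 3) ∘ (extChartAt (𝓡 3) b).symm =ᶠ[𝓝 (extChartAt (𝓡 3) b b)] id := by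
  filter_upwards [extChartAt_target_mem_nhds (I := 𝓡 3) b] with y hy
  exact (extChartAt (𝓡 3) b).right_inv hy

lemma mvfderiv_coe_unitBall (b : unitBall) (v : TangentSpace (𝓡 3) b) :
    mvfderiv (𝓡 3) ((↑) : unitBall → Euc 3) b v = v := by
  have h : MDifferentiableAt (𝓡 3) 𝓘(ℝ, Euc 3) ((↑) : unitBall → Euc 3) b :=
    (contMDiff_subtype_val (n := 1) b).mdifferentiableAt (by simp)
  have h1 : mfderiv (𝓡 3) 𝓘(ℝ, Euc 3) ((↑) : unitBall → Euc 3) b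
      = ContinuousLinearMap.id ℝ (Euc 3) := by
    rw [h.mfderiv]
    have h2 : writtenInExtChartAt (𝓡 3) 𝓘(ℝ, Euc 3) b ((↑) : unitBall → Euc 3)
        =ᶠ[𝓝 (extChartAt (𝓡 3) b b)] id := coe_extChartAt_unitBall_symm b
    simp only [modelWithCornersSelf_coe, Set.range_id, fderivWithin_univ]
    rw [h2.fderiv_eq, fderiv_id]
  exact DFunLike.congr_fun h1 v

lemma dotForm_self_pos {E : Type} [NormedAddCommGroup E] [InnerProductSpace ℝ E] {v : E}
    (hv : v ≠ 0) : 0 < dotForm E v v := real_inner_self_pos.2 hv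

/-- The metric of the quotient. -/
def ballMetric : SmoothMetric 3 unitBall :=
  pullbackMetric ((↑) : unitBall → Euc 3) contMDiff_subtype_val
    (fun b => (ballFactor b ^ 2)⁻¹ • dotForm (Euc 3))
    (fun _ => (((contDiff_ballFactor.pow 2).inv
      fun b => (pow_pos (ballFactor_pos b) 2).ne').smul contDiff_const).contDiffAt)
    (fun _ u v => by simp [real_inner_comm]) fun b v hv => by
      rw [mvfderiv_coe_unitBall]
      have := ballFactor_pos b
      have hv' : 0 < dotForm (Euc 3) v v := dotForm_self_pos hv
      exact mul_pos (by positivity) hv'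

lemma ballMetric_inner (b : unitBall) (u v : TangentSpace (𝓡 3) b) :
    ballMetric.inner b u v = (ballFactor b ^ 2)⁻¹ * dotForm (Euc 3) u v := by
  refine Eq.trans (b := (ballFactor b ^ 2)⁻¹ *
    dotForm (Euc 3) (mvfderiv (𝓡 3) ((↑) : unitBall → Euc 3) b u)
      (mvfderiv (𝓡 3) ((↑) : unitBall → Euc 3) b v)) rfl ?_
  rw [mvfderiv_coe_unitBall, mvfderiv_coe_unitBall]

lemma le_ricciCoord_ball (b v : Euc 3) : (ballFactor b ^ 2)⁻¹ * dotForm (Euc 3) v v ≤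
    ricciCoord (fun y => ((ballFactor (id y) ^ 2)⁻¹ • dotForm (Euc 3)).bilinearComp
      (fderiv ℝ id y) (fderiv ℝ id y)) b v v := by
  rw [ricciCoord_conformal (U := ballFactor) (g := ballGrad)
    (Filter.Eventually.of_forall fun z => ?_)
    (Filter.Eventually.of_forall hasFDerivAt_ballFactor) (hasFDerivAt_ballGrad b)
    (inner_ballHess b) (ballFactor_pos b).ne', inv_mul_eq_div]
  · exact div_le_div_of_nonneg_right (ball_ricci_bound b v) (sq_nonneg _)
  · ext u w
    simp

lemma le_ricci_ballMetric (b : unitBall) (v : TangentSpace (𝓡 3) b) :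
    ballMetric.inner b v v ≤ ricci ballMetric b v v := by
  rw [ballMetric_inner, ricci_eq_ricciCoord (F := ((↑) : unitBall → Euc 3)) contMDiff_subtype_val
    (H := fun b => (ballFactor b ^ 2)⁻¹ • dotForm (Euc 3)) (g := ballMetric)
    (fun _ _ _ => rfl) b (coe_extChartAt_unitBall_symm b) v v]
  exact le_ricciCoord_ball b v

end BallMetric

/-! ### The regular part and its Riemannian quotient -/

section Quotient

open scoped RealInnerProductSpace
open Topology

variable {m : ℕ}

lemma sph_ext {p q : Sph m} (hx : xPart (p : Amb m) = xPart (q : Amb m))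
    (hy : yPart (p : Amb m) = yPart (q : Amb m)) : p = q := Subtype.ext (amb_ext hx hy)

lemma xPart_smul_sph (A : SO m) (p : Sph m) :
    xPart ((A • p : Sph m) : Amb m) = xPart (p : Amb m) := by
  rw [coe_smul_sph, xPart_blockAct]

lemma yPart_smul_sph (A : SO m) (p : Sph m) :
    yPart ((A • p : Sph m) : Amb m) = rot A.1 (yPart (p : Amb m)) := by
  rw [coe_smul_sph, yPart_blockAct]

lemma smul_sph_eq_self_iff (A : SO m) (p : Sph m) :
    A • p = p ↔ rot A.1 (yPart (p : Amb m)) = yPart (p : Amb m) := by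
  rw [← yPart_smul_sph]
  exact ⟨fun h => by rw [h], sph_ext (xPart_smul_sph A p)⟩

/-- Points of the sphere with given components. -/
def mkSph (x : Euc 3) (y : Euc m) (h : ‖x‖ ^ 2 + ‖y‖ ^ 2 = 1) : Sph m :=
  ⟨pairAmb x y, by
    rw [mem_sphere_zero_iff_norm, ← sq_eq_sq₀ (norm_nonneg _) zero_le_one, norm_sq_amb]
    simpa using h⟩

lemma coe_mkSph (x : Euc 3) (y : Euc m) (h : ‖x‖ ^ 2 + ‖y‖ ^ 2 = 1) :
    (mkSph x y h : Amb m) = pairAmb x y := rfl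

/-- If `y = 0` the isotropy group is everything, yet a nonzero vector can be rotated to its
negative. If `y ≠ 0`, rotate the `ℝᵐ` part of `q` onto the line of `y`: whatever fixes `y` fixes
that line. -/
lemma mem_regularPart_iff (hm : 3 ≤ m) (p : Sph m) :
    p ∈ regularPart m ↔ yPart (p : Amb m) ≠ 0 := by
  constructor
  · intro h hp
    let e : Euc m := EuclideanSpace.single ⟨0, by omega⟩ 1
    have he : ‖e‖ = 1 := by simp [e]
    obtain ⟨A, hA⟩ := h (mkSph 0 e (by simp [he]))
    have hfix : ∀ B : SO m, rot B.1 (rot A.1 e) = rot A.1 e := by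
      intro B
      have hB : B ∈ MulAction.stabilizer (SO m) p := by
        rw [MulAction.mem_stabilizer_iff, smul_sph_eq_self_iff, hp, map_zero]
      have h1 := MulAction.mem_stabilizer_iff.1 (hA hB)
      rwa [smul_sph_eq_self_iff, yPart_smul_sph, coe_mkSph, yPart_pairAmb] at h1
    obtain ⟨B, hB⟩ := exists_SO_eq hm (a := rot A.1 e) (b := -rot A.1 e) (by rw [norm_neg])
    rw [hfix B] at hB
    have h1 := eq_neg_iff_add_eq_zero.1 hB
    rw [← two_smul ℝ] at h1
    have h0 := (smul_eq_zero.1 h1).resolve_left two_ne_zero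
    have h2 := norm_rot A e
    rw [h0, norm_zero, he] at h2
    exact zero_ne_one h2
  · intro hp q
    have hp' : ‖yPart (p : Amb m)‖ ≠ 0 := norm_ne_zero_iff.2 hp
    obtain ⟨A, hA⟩ := exists_SO_eq hm (a := yPart (q : Amb m))
      (b := (‖yPart (q : Amb m)‖ / ‖yPart (p : Amb m)‖) • yPart (p : Amb m)) (by
        rw [norm_smul, Real.norm_eq_abs, abs_of_nonneg (by positivity), div_mul_cancel₀ _ hp'])
    refine ⟨A, fun B hB => ?_⟩
    rw [MulAction.mem_stabilizer_iff, smul_sph_eq_self_iff] at hB ⊢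
    rw [yPart_smul_sph, hA, map_smul, hB]

lemma mem_orbit_iff (hm : 3 ≤ m) (p q : Sph m) : q ∈ MulAction.orbit (SO m) p ↔
    xPart (p : Amb m) = xPart (q : Amb m) ∧ ‖yPart (p : Amb m)‖ = ‖yPart (q : Amb m)‖ := by
  constructor
  · rintro ⟨A, rfl⟩
    exact ⟨(xPart_smul_sph A p).symm, by simp only [yPart_smul_sph, norm_rot]⟩
  · rintro ⟨hx, hy⟩
    obtain ⟨A, hA⟩ := exists_SO_eq hm hy
    exact ⟨A, sph_ext ((xPart_smul_sph A p).trans hx) ((yPart_smul_sph A p).trans hA)⟩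

/-- The map `(x, y) ↦ x / (1 + |y|)` from the sphere to the ball. -/
def ballMap (q : Amb m) : Euc 3 := (1 + ‖yPart q‖)⁻¹ • xPart q

lemma contDiffAt_ballMap {q : Amb m} (hq : yPart q ≠ 0) : ContDiffAt ℝ ∞ ballMap q := by
  have h1 : ContDiffAt ℝ ∞ (fun q : Amb m => ‖yPart q‖) q :=
    (contDiffAt_norm ℝ hq).comp q yPart.contDiff.contDiffAt
  exact ((contDiffAt_const.add h1).inv (by positivity)).smul xPart.contDiff.contDiffAt

lemma fderiv_ballMap {q : Amb m} (hq : yPart q ≠ 0) (w : Amb m) : fderiv ℝ ballMap q w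
    = (1 + ‖yPart q‖)⁻¹ • xPart w - ((1 + ‖yPart q‖)⁻¹ ^ 2 * (⟪yPart q, yPart w⟫ / ‖yPart q‖)) •
      xPart q := by
  have hr : ‖yPart q‖ ≠ 0 := norm_ne_zero_iff.2 hq
  have h1 : HasFDerivAt (fun q : Amb m => ‖yPart q‖)
      ((‖yPart q‖⁻¹ • dotForm (Euc m) (yPart q)).comp yPart) q := by
    have h := ((hasFDerivAt_norm_sq (yPart q)).comp q yPart.hasFDerivAt).sqrt
      (pow_ne_zero 2 hr)
    have h' : (fun q : Amb m => √(((fun y : Euc m => ‖y‖ ^ 2) ∘ yPart) q)) = fun q => ‖yPart q‖ := by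
      funext q
      exact Real.sqrt_sq (norm_nonneg _)
    rw [h'] at h
    refine h.congr_fderiv (ContinuousLinearMap.ext fun e => ?_)
    simp
    field_simp
  have h2 : HasFDerivAt (fun q : Amb m => (1 + ‖yPart q‖)⁻¹) _ q :=
    (hasDerivAt_inv (show 1 + ‖yPart q‖ ≠ 0 by positivity)).comp_hasFDerivAt q (h1.const_add 1)
  have h3 : HasFDerivAt ballMap _ q := h2.smul (xPart.hasFDerivAt (x := q))
  rw [h3.fderiv]
  simp
  rw [sub_eq_add_neg]
  congr 1
  match_scalars
  field_simp

lemma norm_sq_ballMap (p : Sph m) :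
    ‖ballMap (p : Amb m)‖ ^ 2 = (1 - ‖yPart (p : Amb m)‖) / (1 + ‖yPart (p : Amb m)‖) := by
  have h := norm_sq_sph p
  rw [ballMap, norm_smul, mul_pow, Real.norm_eq_abs, sq_abs, ← sub_eq_iff_eq_add.2 h.symm]
  have : 1 + ‖yPart (p : Amb m)‖ ≠ 0 := by positivity
  field_simp
  ring

lemma ballMap_mem_ball {p : Sph m} (hp : yPart (p : Amb m) ≠ 0) :
    ballMap (p : Amb m) ∈ Metric.ball (0 : Euc 3) 1 := by
  rw [mem_ball_zero_iff, ← sq_lt_one_iff₀ (norm_nonneg _), norm_sq_ballMap,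
    div_lt_one (by positivity)]
  have := norm_pos_iff.2 hp
  linarith

open Classical in
/-- The projection to the quotient. -/
def quotMap (p : Sph m) : unitBall :=
  if h : ballMap (p : Amb m) ∈ Metric.ball (0 : Euc 3) 1 then ⟨ballMap (p : Amb m), h⟩
  -- Default value at the singular points, which `ballMap` sends to the boundary sphere.
  else ⟨0, Metric.mem_ball_self one_pos⟩

lemma coe_quotMap {p : Sph m} (hp : yPart (p : Amb m) ≠ 0) :
    (quotMap p : Euc 3) = ballMap (p : Amb m) := by
  rw [quotMap, dif_pos (ballMap_mem_ball hp)]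

lemma coe_quotMap_eventuallyEq {p : Sph m} (hp : yPart (p : Amb m) ≠ 0) :
    (Subtype.val ∘ quotMap : Sph m → Euc 3) =ᶠ[𝓝 p] fun p => ballMap (p : Amb m) := by
  have hc : Continuous fun p : Sph m => yPart (p : Amb m) := by fun_prop
  filter_upwards [(isOpen_ne.preimage hc).mem_nhds hp] with q hq
  exact coe_quotMap hq

lemma contMDiffAt_quotMap {p : Sph m} (hp : yPart (p : Amb m) ≠ 0) :
    ContMDiffAt (𝓡 (m + 2)) (𝓡 3) ∞ quotMap p := by
  refine (ContMDiffAt.subtypeVal_comp_iff unitBall quotMap p).1 ?_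
  refine ContMDiffAt.congr_of_eventuallyEq ?_ (coe_quotMap_eventuallyEq hp)
  exact (contDiffAt_ballMap hp).contMDiffAt.comp p (contMDiff_coe_sphere p)

lemma mfderiv_quotMap {p : Sph m} (hp : yPart (p : Amb m) ≠ 0)
    (u : TangentSpace (𝓡 (m + 2)) p) :
    mfderiv (𝓡 (m + 2)) (𝓡 3) quotMap p u = fderiv ℝ ballMap (p : Amb m) (sphIncl p u) := by
  have h1 : HasMFDerivAt (𝓡 (m + 2)) 𝓘(ℝ, Euc 3) (Subtype.val ∘ quotMap : Sph m → Euc 3) p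
      ((mfderiv (𝓡 3) 𝓘(ℝ, Euc 3) (Subtype.val : unitBall → Euc 3) (quotMap p)).comp
        (mfderiv (𝓡 (m + 2)) (𝓡 3) quotMap p)) :=
    HasMFDerivAt.comp p
      ((contMDiff_subtype_val (n := 1) (quotMap p)).mdifferentiableAt (by simp)).hasMFDerivAt
      ((contMDiffAt_quotMap hp).mdifferentiableAt (by simp)).hasMFDerivAt
  have h2 : HasMFDerivAt (𝓡 (m + 2)) 𝓘(ℝ, Euc 3) (fun p : Sph m => ballMap (p : Amb m)) p
      ((fderiv ℝ ballMap (p : Amb m)).comp (sphIncl p)) :=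
    HasMFDerivAt.comp (g := (ballMap : Amb m → Euc 3)) p
      ((contDiffAt_ballMap hp).differentiableAt (by simp)).hasFDerivAt.hasMFDerivAt
      (hasMFDerivAt_coe_sph p)
  have h3 := hasMFDerivAt_unique (h1.congr_of_eventuallyEq (coe_quotMap_eventuallyEq hp).symm) h2
  exact (mvfderiv_coe_unitBall _ _).symm.trans (DFunLike.congr_fun h3 u)

/-- The denominator is the factor by which `ballMap` shrinks horizontal vectors
(`inner_fderiv_ballMap`), so the two cancel and `confFactor` remains. -/
lemma ballFactor_ballMap (p : Sph m) : ballFactor (ballMap (p : Amb m))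
    = (7 + 3 * (xPart (p : Amb m) 0 ^ 2 + xPart (p : Amb m) 1 ^ 2)) /
      (1 + ‖yPart (p : Amb m)‖) := by
  have hr : 1 + ‖yPart (p : Amb m)‖ ≠ 0 := by positivity
  have h : 1 + (1 - ‖yPart (p : Amb m)‖) / (1 + ‖yPart (p : Amb m)‖)
      = 2 / (1 + ‖yPart (p : Amb m)‖) := by
    field_simp
    ring
  rw [ballFactor, norm_sq_ballMap, h, inner_planeProj, ballMap]
  simp only [PiLp.smul_apply, smul_eq_mul]
  field_simp
  ring

lemma exists_fderiv_ballMap_eq {p : Sph m} (hp : yPart (p : Amb m) ≠ 0) (v : Euc 3) :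
    ∃ w : Amb m, ⟪(p : Amb m), w⟫ = 0 ∧ fderiv ℝ ballMap (p : Amb m) w = v := by
  have hr : ‖yPart (p : Amb m)‖ ≠ 0 := norm_ne_zero_iff.2 hp
  have hr' : 1 + ‖yPart (p : Amb m)‖ ≠ 0 := by positivity
  have hx : ‖xPart (p : Amb m)‖ ^ 2 = 1 - ‖yPart (p : Amb m)‖ ^ 2 :=
    eq_sub_of_add_eq (norm_sq_sph p)
  -- The lift with `ℝᵐ` part radial: tangency to the sphere fixes the multiple of `y`.
  refine ⟨pairAmb ((1 + ‖yPart (p : Amb m)‖) • v - ⟪xPart (p : Amb m), v⟫ • xPart (p : Amb m))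
    (-((1 + ‖yPart (p : Amb m)‖) * ⟪xPart (p : Amb m), v⟫ / ‖yPart (p : Amb m)‖) •
      yPart (p : Amb m)), ?_, ?_⟩
  · simp only [inner_amb, xPart_pairAmb, yPart_pairAmb, inner_sub_right, inner_smul_right,
      real_inner_self_eq_norm_sq, hx]
    field_simp
    ring
  · rw [fderiv_ballMap hp]
    simp only [xPart_pairAmb, yPart_pairAmb, inner_smul_right, real_inner_self_eq_norm_sq]
    match_scalars
    · field_simp
    · field_simp
      ring

/-- On tangent vectors with radial `ℝᵐ` part, `ballMap` acts as stereographic projection of a half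
of `S³`, which is conformal. -/
lemma inner_fderiv_ballMap {p : Sph m} (hp : yPart (p : Amb m) ≠ 0) {w w' : Amb m} {k k' : ℝ}
    (hw : ⟪(p : Amb m), w⟫ = 0) (hw' : ⟪(p : Amb m), w'⟫ = 0)
    (hk : yPart w = k • yPart (p : Amb m)) (hk' : yPart w' = k' • yPart (p : Amb m)) :
    ⟪fderiv ℝ ballMap (p : Amb m) w, fderiv ℝ ballMap (p : Amb m) w'⟫
      = (1 + ‖yPart (p : Amb m)‖)⁻¹ ^ 2 * ⟪w, w'⟫ := by
  have hr : ‖yPart (p : Amb m)‖ ≠ 0 := norm_ne_zero_iff.2 hp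
  have hr' : 1 + ‖yPart (p : Amb m)‖ ≠ 0 := by positivity
  have hx : ‖xPart (p : Amb m)‖ ^ 2 = 1 - ‖yPart (p : Amb m)‖ ^ 2 :=
    eq_sub_of_add_eq (norm_sq_sph p)
  rw [inner_amb, hk, inner_smul_right, real_inner_self_eq_norm_sq, add_eq_zero_iff_eq_neg] at hw
  rw [inner_amb, hk', inner_smul_right, real_inner_self_eq_norm_sq, add_eq_zero_iff_eq_neg] at hw'
  rw [fderiv_ballMap hp, fderiv_ballMap hp, inner_amb, hk, hk']
  simp only [inner_sub_left, inner_sub_right, inner_smul_right, real_inner_smul_left,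
    real_inner_self_eq_norm_sq, real_inner_comm (xPart (p : Amb m)) (xPart w), hw, hw', hx]
  field_simp
  ring

/-- The part `η` of the `ℝᵐ` component orthogonal to `y` gives a kernel vector `(0, η)`; testing
horizontality against it yields `⟪η, η⟫ = 0`. -/
lemma exists_yPart_eq_smul {p : Sph m} (hp : yPart (p : Amb m) ≠ 0)
    (z : TangentSpace (𝓡 (m + 2)) p)
    (hz : ∀ k, mfderiv (𝓡 (m + 2)) (𝓡 3) quotMap p k = 0 →
      (cheegerMetric m le_rfl).inner p z k = 0) :
    ∃ k : ℝ, yPart (sphIncl p z) = k • yPart (p : Amb m) := by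
  have hr : ‖yPart (p : Amb m)‖ ≠ 0 := norm_ne_zero_iff.2 hp
  set k : ℝ := ⟪yPart (p : Amb m), yPart (sphIncl p z)⟫ / ‖yPart (p : Amb m)‖ ^ 2 with hk
  set η : Euc m := yPart (sphIncl p z) - k • yPart (p : Amb m) with hη
  have hη0 : ⟪yPart (p : Amb m), η⟫ = 0 := by
    rw [hη, inner_sub_right, inner_smul_right, real_inner_self_eq_norm_sq, hk]
    field_simp
    ring
  obtain ⟨u, hu⟩ := exists_sphIncl_eq p (w := pairAmb 0 η) (by simp [inner_amb, hη0])
  have h0 : fderiv ℝ ballMap (p : Amb m) (pairAmb 0 η) = 0 := by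
    rw [fderiv_ballMap hp, xPart_pairAmb, yPart_pairAmb, hη0]
    simp
  have h1 := hz u ((mfderiv_quotMap hp u).trans ((congrArg _ hu).trans h0))
  rw [cheegerMetric_inner, ambForm_zero, hu, inner_pairAmb_zero] at h1
  have h2 := (mul_eq_zero.1 h1).resolve_left (confFactor_pos _).ne'
  have h3 : ⟪η, η⟫ = 0 := by
    nth_rw 1 [hη]
    rw [inner_sub_left, real_inner_smul_left, hη0, h2]
    ring
  exact ⟨k, sub_eq_zero.1 (inner_self_eq_zero.1 h3)⟩

lemma isMetricSubmersion_quotMap {p : Sph m} (hp : yPart (p : Amb m) ≠ 0) :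
    IsMetricSubmersion (fun u v => (cheegerMetric m le_rfl).inner p u v)
      (fun u v => ballMetric.inner (quotMap p) u v)
      (fun u => mfderiv (𝓡 (m + 2)) (𝓡 3) quotMap p u) := by
  constructor
  · intro v
    obtain ⟨w, hw, hw'⟩ := exists_fderiv_ballMap_eq hp v
    obtain ⟨u, rfl⟩ := exists_sphIncl_eq p hw
    exact ⟨u, (mfderiv_quotMap hp u).trans hw'⟩
  · intro z z' hz hz'
    obtain ⟨k, hk⟩ := exists_yPart_eq_smul hp z hz
    obtain ⟨k', hk'⟩ := exists_yPart_eq_smul hp z' hz'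
    have h : ballMetric.inner (quotMap p) (mfderiv (𝓡 (m + 2)) (𝓡 3) quotMap p z)
        (mfderiv (𝓡 (m + 2)) (𝓡 3) quotMap p z') = (ballFactor (ballMap (p : Amb m)) ^ 2)⁻¹ *
          ⟪fderiv ℝ ballMap (p : Amb m) (sphIncl p z),
            fderiv ℝ ballMap (p : Amb m) (sphIncl p z')⟫ := by
      rw [ballMetric_inner, mfderiv_quotMap hp, mfderiv_quotMap hp, coe_quotMap hp]
      rfl
    refine h.trans ?_
    change _ = (cheegerMetric m le_rfl).inner p z z'
    rw [cheegerMetric_inner, ambForm_zero,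
      inner_fderiv_ballMap hp (inner_sphIncl p z) (inner_sphIncl p z') hk hk', ballFactor_ballMap,
      confFactor]
    field_simp

/-- By `norm_sq_ballMap`, the length of the image determines `|y|`, and then `x`. -/
lemma ballMap_eq_iff (p q : Sph m) : ballMap (p : Amb m) = ballMap (q : Amb m) ↔
    xPart (p : Amb m) = xPart (q : Amb m) ∧ ‖yPart (p : Amb m)‖ = ‖yPart (q : Amb m)‖ := by
  constructor
  · intro h
    have h1 := norm_sq_ballMap p
    rw [h, norm_sq_ballMap, div_eq_div_iff (by positivity) (by positivity)] at h1
    have h2 : ‖yPart (p : Amb m)‖ = ‖yPart (q : Amb m)‖ := by linarith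
    rw [ballMap, ballMap, h2] at h
    exact ⟨smul_right_injective _ (by positivity) h, h2⟩
  · rintro ⟨hx, hy⟩
    rw [ballMap, ballMap, hx, hy]

lemma exists_ballMap_eq (hm : 3 ≤ m) {b : Euc 3} (hb : b ∈ Metric.ball (0 : Euc 3) 1) :
    ∃ p : Sph m, yPart (p : Amb m) ≠ 0 ∧ ballMap (p : Amb m) = b := by
  have hb1 : ‖b‖ ^ 2 < 1 := by
    rw [mem_ball_zero_iff] at hb
    exact (sq_lt_one_iff₀ (norm_nonneg _)).2 hb
  have hN : 0 < 1 + ‖b‖ ^ 2 := by positivity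
  -- The solution of `|b|² = (1 - r) / (1 + r)`.
  set r : ℝ := (1 - ‖b‖ ^ 2) / (1 + ‖b‖ ^ 2) with hr
  have hr0 : 0 < r := div_pos (by linarith) hN
  let y : Euc m := EuclideanSpace.single ⟨0, by omega⟩ r
  have hy : ‖y‖ = r := by simp [y, abs_of_pos hr0]
  refine ⟨mkSph ((2 / (1 + ‖b‖ ^ 2)) • b) y ?_, ?_, ?_⟩
  · rw [hy, norm_smul, mul_pow, Real.norm_eq_abs, sq_abs, hr]
    field_simp
    ring
  · rw [coe_mkSph, yPart_pairAmb, ← norm_ne_zero_iff, hy]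
    exact hr0.ne'
  · rw [coe_mkSph, ballMap, xPart_pairAmb, yPart_pairAmb, hy, smul_smul]
    have h1 : (1 + r)⁻¹ * (2 / (1 + ‖b‖ ^ 2)) = 1 := by
      have h2 : 1 + r = 2 / (1 + ‖b‖ ^ 2) := by
        rw [hr]
        field_simp
        ring
      rw [h2]
      field_simp
    rw [h1, one_smul]

lemma isRegularQuotient_quotMap (hm : 3 ≤ m) :
    IsRegularQuotient (cheegerMetric m le_rfl) ballMetric quotMap where
  smooth p hp := (contMDiffAt_quotMap ((mem_regularPart_iff hm p).1 hp)).contMDiffWithinAt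
  surj := by
    refine Set.eq_univ_of_forall fun b => ?_
    obtain ⟨p, hp, hpb⟩ := exists_ballMap_eq hm b.2
    exact ⟨p, (mem_regularPart_iff hm p).2 hp, Subtype.ext ((coe_quotMap hp).trans hpb)⟩
  fibres p hp q hq := by
    rw [mem_orbit_iff hm, ← ballMap_eq_iff, ← coe_quotMap ((mem_regularPart_iff hm p).1 hp),
      ← coe_quotMap ((mem_regularPart_iff hm q).1 hq), Subtype.ext_iff]
  submersion p hp := isMetricSubmersion_quotMap ((mem_regularPart_iff hm p).1 hp)

lemma regularQuotientRicciGE_one (hm : 3 ≤ m) :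
    RegularQuotientRicciGE (cheegerMetric m le_rfl) 1 :=
  ⟨3, unitBall, inferInstance, inferInstance, inferInstance, ballMetric, quotMap,
    isRegularQuotient_quotMap hm, fun b v => by
      rw [one_mul]
      exact le_ricci_ballMetric b v⟩

end Quotient

end

/-- For `n ≥ 5`, on the unit sphere of `ℝ³ × ℝ^{n-2} = ℝ^{n+1}` with the standard action of
`SO(n - 2)` on the last `n - 2` coordinates. The deformations start at `g_0 = g`. -/
theorem theorem1p5 (n : ℕ) (hn : 5 ≤ n) :
    ∃ g : SphMetric (n - 2), IsSOInvariant g ∧ RegularQuotientRicciGE g 1 ∧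
      ∃ (p : Sph (n - 2)) (X : TangentSpace (𝓡 (n - 2 + 2)) p), IsHorizontal g p X ∧
        ricci g p X X < 0 ∧
        ∀ (Q : LinearMap.BilinForm ℝ (LieSO (n - 2))) (t : ℝ), IsBiinvariant Q → 0 < t →
          (∃ gt : SphMetric (n - 2), IsCheegerDeformation g Q t gt) ∧
          ∀ gt : SphMetric (n - 2), IsCheegerDeformation g Q t gt → ricci gt p X X < 0 := by
  have hm : 3 ≤ n - 2 := by omega
  obtain ⟨X, hX⟩ := exists_ricci_neg hm
  refine ⟨cheegerMetric (n - 2) le_rfl, cheegerMetric_invariant le_rfl,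
    regularQuotientRicciGE_one hm, basePt (n - 2), X, isHorizontal_basePt _ X,
    hX 0 le_rfl _ (cheegerMetric_inner le_rfl), fun Q t hQ ht => ?_⟩
  -- `κ` depends on `Q`, but `X` was chosen beforehand and works for every `c = t κ ≥ 0`.
  obtain ⟨κ, hκ0, hκ⟩ := exists_rot_momentRep hQ hm
  have hc : 0 ≤ t * κ := by positivity
  exact ⟨⟨_, isCheegerDeformation_cheegerMetric hQ hκ ht hκ0 hc⟩,
    fun gt hgt => hX _ hc gt (hgt.inner_eq hQ hκ ht hκ0)⟩
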